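/- Let $T\ge 1$. Call a complex sequence $\zeta(n)$, $n\in\mathbb Z$, of zero-mean, finite-variance random variables $T$-PC if $E\,\zeta(n+T)\overline{\zeta(m+T)}=E\,\zeta(n)\overline{\zeta(m)}$ for all $n,m$ (minimality of the period is not needed). Let $\zeta,\theta$ be uncorrelated $T$-PC sequences, $E\,\zeta(n)\overline{\theta(m)}=0$ for all $n,m$, whose $T$-blocked sequences $\vec\zeta(n)=(\zeta(nT+\nu))_{\nu=1}^T$, $\vec\theta(n)=(\theta(nT+\nu))_{\nu=1}^T$ have spectral density matrices $f,g$ on $(-\pi,\pi]$, i.e. $f,g$ are integrable, positive semidefinite a.e. and $$E\,\zeta_\nu(n)\overline{\zeta_\mu(m)}=\frac1{2\pi}\int_{-\pi}^{\pi}e^{i(n-m)\lambda}f_{\nu\mu}(\lambda)\,d\lambda ,$$ and similarly for $\theta,g$. Assume that $f+g$ is invertible a.e. and $\int_{-\pi}^{\pi}\operatorname{Tr}\,(f(\lambda)+g(\lambda))^{-1}d\lambda<\infty$ (minimality condition). Let $s\ge 0$, let $N_k,K_k$ be nonnegative integers, $M_l=\sum_{k=1}^l(N_k+K_k)$, and put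 $$S=\bigcup_{l=1}^s\{-M_lT+1,\dots,-M_{l-1}T-N_lT\},\quad \widetilde S=\bigcup_{l=1}^s\{-M_l,\dots,-M_{l-1}-N_l-1\},\quad \Gamma=\widetilde S\cup\{0,1,2,\dots\}.$$ Let $\sum_{j\ge1}|a(j)|<\infty$, $\vec a(n)=(a(nT+\nu))_{\nu=1}^T$ for $n\ge0$, $A(e^{i\lambda})=\sum_{n\ge0}\vec a(n)e^{in\lambda}$, and let $\mathbf a=(\mathbf a(n))_{n\in\Gamma}$ with $\mathbf a(n)=\vec a(n)$ for $n\ge0$ and $\mathbf a(n)=0$ for $n<0$. Let $\mathbf B,\mathbf R,\mathbf D$ be the block matrices $(B(m-n))$, $(R(m-n))$, $(D(m-n))$, $m,n\in\Gamma$, where $$B(k)=\frac1{2\pi}\int_{-\pi}^{\pi}\big[(f+g)^{-1}\big]^{\top}e^{-ik\lambda}d\lambda,\quad R(k)=\frac1{2\pi}\int_{-\pi}^{\pi}\big[f(f+g)^{-1}\big]^{\top}e^{-ik\lambda}d\lambda,\quad D(k)=\frac1{2\pi}\int_{-\pi}^{\pi}\big[f(f+g)^{-1}g\big]^{\top}e^{-ik\lambda}d\lambda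 .$$ Assume that $\mathbf B$ is an invertible linear operator in $\ell^2(\Gamma;\mathbb C^T)$: the columns of the matrix are square summable, and $x\mapsto\mathbf Bx$ maps $\{x\in\ell^2:\mathbf Bx \text{ exists and lies in }\ell^2\}$ bijectively onto $\ell^2$ ($\mathbf B$ need not be bounded). Then $A\zeta=\sum_{j\ge1}a(j)\zeta(j)$ converges in $L^2(P)$, $\mathbf R\mathbf a\in\ell^2$, and with $\mathbf c=\mathbf B^{-1}\mathbf R\mathbf a$ and $C(e^{i\lambda})=\sum_{n\in\Gamma}\mathbf c(n)e^{in\lambda}$ (convergent in $L^2(-\pi,\pi)$) the following holds. The function $$\vec h^{\top}=\big(A^{\top}f-C^{\top}\big)(f+g)^{-1}=A^{\top}-\big(A^{\top}g+C^{\top}\big)(f+g)^{-1}$$ is, uniquely up to a.e. equality, the spectral characteristic of the optimal linear estimate of $A\zeta$ from the observations $\zeta(j)+\theta(j)$, $j\le0$, $j\notin S$. That is, it is the minimizer of $$\Delta(\vec h;f,g)=\frac1{2\pi}\int_{-\pi}^{\pi}(A-\vec h)^{\top}f\,\overline{(A-\vec h)}\,d\lambda+\frac1{2\pi}\int_{-\pi}^{\pi}\vec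 h^{\top}g\,\overline{\vec h}\,d\lambda$$ over $L_2^s(f+g)$, the closed subspace of $L_2(f+g)$ generated by $e^{ij\lambda}\delta_\nu$ with $j\le-1$, $j\notin\widetilde S$, $1\le\nu\le T$ ($\delta_\nu$ the coordinate vectors of $\mathbb C^T$), and the unique element $\widehat{A\zeta}$ of smallest mean-square error $E|A\zeta-\widehat{A\zeta}|^2$ in the closed linear span in $L^2(P)$ of the observations is $$\widehat{A\zeta}=\int_{-\pi}^{\pi}\vec h^{\top}(e^{i\lambda})\,\big(Z^{\vec\zeta}+Z^{\vec\theta}\big)(d\lambda),$$ where $Z^{\vec\zeta},Z^{\vec\theta}$ are the orthogonal random measures of $\vec\zeta,\vec\theta$. Moreover $$E|A\zeta-\widehat{A\zeta}|^2=\Delta(\vec h;f,g)=\langle\mathbf D\mathbf a,\mathbf a\rangle+\langle\mathbf B\mathbf c,\mathbf c\rangle ,\qquad \langle x,y\rangle=\sum_{n\in\Gamma}x(n)^{\top}\overline{y(n)} .$$ -/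

import Mathlib

open MeasureTheory Filter Topology Set
open scoped Real Matrix ENNReal ComplexConjugate ComplexOrder

noncomputable section

/-! ### Periodically correlated sequences and their blocks -/

section Sequences

variable {Ω : Type*} [MeasurableSpace Ω]

/-- A zero mean, finite variance complex sequence whose covariance is periodic with period `T`.
(`T` is not required to be the smallest period.) -/
structure IsPeriodicallyCorrelated (P : Measure Ω) (T : ℕ) (ζ : ℤ → Ω → ℂ) : Prop where
  memLp : ∀ n, MemLp (ζ n) 2 P
  mean_zero : ∀ n, ∫ ω, ζ n ω ∂P = 0
  periodic : ∀ n m, ∫ ω, ζ (n + T) ω * conj (ζ (m + T) ω) ∂P = ∫ ω, ζ n ω * conj (ζ m ω) ∂P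

/-- The members of the sequence as elements of the Hilbert space `L²(P)`. -/
def IsPeriodicallyCorrelated.toL2 {P : Measure Ω} {T : ℕ} {ζ : ℤ → Ω → ℂ}
    (h : IsPeriodicallyCorrelated P T ζ) (n : ℤ) : Lp ℂ 2 P :=
  (h.memLp n).toLp (ζ n)

/-- `ζ` and `θ` are uncorrelated. -/
def Uncorrelated (P : Measure Ω) (ζ θ : ℤ → Ω → ℂ) : Prop :=
  ∀ n m, ∫ ω, ζ n ω * conj (θ m ω) ∂P = 0

/-- The `T`-blocking of a sequence: the component `p = ν + 1` (`p = 1, …, T`) of the `n`-th block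
is the term with index `n T + p`. -/
def block {α : Type*} (T : ℕ) (x : ℤ → α) (n : ℤ) (ν : Fin T) : α :=
  x (n * T + ((ν : ℕ) : ℤ) + 1)

/-- The frequency interval `(-π, π]` with Lebesgue measure. -/
def freqMeasure : Measure ℝ := volume.restrict (Ioc (-π) π)

/-- The exponential `e^{i n t}`. -/
def expI (n : ℤ) (t : ℝ) : ℂ := Complex.exp (Complex.I * n * t)

/-- `f` is the spectral density matrix of the `T`-variate sequence obtained by `T`-blocking of `ζ`:
`E ζ_ν(n) conj (ζ_μ(m)) = (1/2π) ∫ e^{i(n-m)t} f_{νμ}(t) dt`. -/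
structure IsSpectralDensity (P : Measure Ω) {T : ℕ} (ζ : ℤ → Ω → ℂ)
    (f : ℝ → Matrix (Fin T) (Fin T) ℂ) : Prop where
  integrable : ∀ ν μ, Integrable (fun t => f t ν μ) freqMeasure
  posSemidef : ∀ᵐ t ∂freqMeasure, (f t).PosSemidef
  covariance : ∀ (n m : ℤ) (ν μ : Fin T),
    ∫ ω, block T ζ n ν ω * conj (block T ζ m μ ω) ∂P =
      (1 / (2 * π) : ℂ) * ∫ t, expI (n - m) t * f t ν μ ∂freqMeasure

end Sequences

/-! ### Missing observations -/

/-- `M_l = ∑_{k=1}^{l} (N_k + K_k)`. -/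
def gapM (N K : ℕ → ℕ) (l : ℕ) : ℕ := ∑ k ∈ Finset.Icc 1 l, (N k + K k)

/-- `S = ⋃_{l=1}^{s} {-M_l T + 1, …, -M_{l-1} T - N_l T}`. -/
def gapSet (T s : ℕ) (N K : ℕ → ℕ) : Set ℤ :=
  {j | ∃ l, 1 ≤ l ∧ l ≤ s ∧ -(gapM N K l * T : ℤ) + 1 ≤ j ∧
    j ≤ -(gapM N K (l - 1) * T : ℤ) - N l * T}

/-- The gap set for the blocks, `⋃_{l=1}^{s} {-M_l, …, -M_{l-1} - N_l - 1}`. -/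
def blockGapSet (s : ℕ) (N K : ℕ → ℕ) : Set ℤ :=
  {j | ∃ l, 1 ≤ l ∧ l ≤ s ∧ -(gapM N K l : ℤ) ≤ j ∧ j ≤ -(gapM N K (l - 1) : ℤ) - N l - 1}

/-- `Γ`: the missing negative blocks together with `0, 1, 2, …`. -/
def gammaSet (s : ℕ) (N K : ℕ → ℕ) : Set ℤ := blockGapSet s N K ∪ {j | 0 ≤ j}

/-- The closed linear subspace of `L²(P)` generated by the terms of `X` that are observed: those
with index `j ≤ 0`, `j ∉ S`. -/
def observationSpace {Ω : Type*} [MeasurableSpace Ω] {P : Measure Ω}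
    (X : ℤ → Lp ℂ 2 P) (S : Set ℤ) : Submodule ℂ (Lp ℂ 2 P) :=
  (Submodule.span ℂ (X '' {j | j ≤ 0 ∧ j ∉ S})).topologicalClosure

/-- `E|ξ - η|²`. -/
def meanSquare {Ω : Type*} [MeasurableSpace Ω] {P : Measure Ω} (ξ η : Lp ℂ 2 P) : ℝ :=
  ∫ ω, ‖ξ ω - η ω‖ ^ 2 ∂P

/-- `η` is the optimal linear estimate of `ξ` in the subspace `H`: it lies in `H` and has the
smallest mean-square error among the elements of `H`. -/
def IsOptimalEstimate {Ω : Type*} [MeasurableSpace Ω] {P : Measure Ω}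
    (H : Submodule ℂ (Lp ℂ 2 P)) (ξ η : Lp ℂ 2 P) : Prop :=
  η ∈ H ∧ ∀ η' ∈ H, meanSquare ξ η ≤ meanSquare ξ η'

/-! ### The spaces `L₂(F)` and `L₂ˢ(F)`, spectral integrals -/

/-- `bᵀ F b̄`. -/
def quadForm {T : ℕ} (F : Matrix (Fin T) (Fin T) ℂ) (b : Fin T → ℂ) : ℂ :=
  (b ᵥ* F) ⬝ᵥ star b

/-- `b` belongs to `L₂(F)`. -/
def MemL2Density {T : ℕ} (F : ℝ → Matrix (Fin T) (Fin T) ℂ) (b : ℝ → Fin T → ℂ) : Prop :=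
  AEStronglyMeasurable b freqMeasure ∧ Integrable (fun t => quadForm (F t) (b t)) freqMeasure

/-- The squared norm `∫ bᵀ F b̄` of `L₂(F)`. -/
def sqNormDensity {T : ℕ} (F : ℝ → Matrix (Fin T) (Fin T) ℂ) (b : ℝ → Fin T → ℂ) : ℝ :=
  ∫ t, (quadForm (F t) (b t)).re ∂freqMeasure

/-- The vector trigonometric polynomial `∑ p(j, ν) e^{i j t} δ_ν`. -/
def trigPoly {T : ℕ} (p : (ℤ × Fin T) →₀ ℂ) (t : ℝ) : Fin T → ℂ :=
  p.sum fun k z => (z * expI k.1 t) • Pi.single k.2 1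

/-- `b` belongs to `L₂ˢ(F)`, the closed subspace of `L₂(F)` generated by the functions
`e^{i j t} δ_ν`, `j ≤ -1`, `j ∉ G`. -/
def MemL2Observed {T : ℕ} (F : ℝ → Matrix (Fin T) (Fin T) ℂ) (G : Set ℤ)
    (b : ℝ → Fin T → ℂ) : Prop :=
  MemL2Density F b ∧ ∀ ε > 0, ∃ p : (ℤ × Fin T) →₀ ℂ,
    (∀ k ∈ p.support, k.1 ≤ -1 ∧ k.1 ∉ G) ∧
      sqNormDensity F (fun t => b t - trigPoly p t) < ε

/-- `η = ∫ hᵀ(e^{it}) Z(dt)`, where `Z` is the orthogonal random measure of the `T`-variate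
stationary sequence obtained by blocking of `X`, and `F` is its spectral density: the image of `h`
under the isometric linear map that is the closure of `e^{i j t} δ_ν ↦ X_ν(j)`. -/
def IsSpectralIntegral {Ω : Type*} [MeasurableSpace Ω] {P : Measure Ω} {T : ℕ}
    (X : ℤ → Lp ℂ 2 P) (F : ℝ → Matrix (Fin T) (Fin T) ℂ)
    (h : ℝ → Fin T → ℂ) (η : Lp ℂ 2 P) : Prop :=
  MemL2Density F h ∧ ∀ ε > 0, ∃ p : (ℤ × Fin T) →₀ ℂ,
    sqNormDensity F (fun t => h t - trigPoly p t) < ε ∧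
      ‖η - p.sum (fun k z => z • block T X k.1 k.2)‖ < ε

/-! ### The functional -/

/-- The vectors `a(n)`, with components `a_ν(n) = a(n T + ν)` for `n ≥ 0`, extended by zero. -/
def coeffVec (T : ℕ) (a : ℕ → ℂ) (n : ℤ) (ν : Fin T) : ℂ :=
  if 0 ≤ n then a (n.toNat * T + ν + 1) else 0

/-- The vector `𝐚` over `Γ`: zero at the negative indices, `a(n)` at `n ≥ 0`. -/
def coeffOn (T : ℕ) (a : ℕ → ℂ) (Γ : Set ℤ) (n : Γ) : Fin T → ℂ := coeffVec T a n

/-- `A(e^{it}) = ∑_{n ≥ 0} a(n) e^{i n t}`. -/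
def symbolA (T : ℕ) (a : ℕ → ℂ) (t : ℝ) (ν : Fin T) : ℂ :=
  ∑' n : ℕ, coeffVec T a n ν * expI n t

/-- The mean-square error, in spectral terms, of the estimate with spectral characteristic `h`. -/
def spectralError {T : ℕ} (a : ℕ → ℂ) (f g : ℝ → Matrix (Fin T) (Fin T) ℂ)
    (h : ℝ → Fin T → ℂ) : ℝ :=
  1 / (2 * π) * sqNormDensity f (fun t => symbolA T a t - h t) +
    1 / (2 * π) * sqNormDensity g h

/-- `h` is a spectral characteristic of the optimal linear estimate: it minimizes the mean-square
error over `L₂ˢ(f + g)`. -/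
def IsOptimalCharacteristic {T : ℕ} (a : ℕ → ℂ) (f g : ℝ → Matrix (Fin T) (Fin T) ℂ)
    (G : Set ℤ) (h : ℝ → Fin T → ℂ) : Prop :=
  MemL2Observed (fun t => f t + g t) G h ∧
    ∀ h', MemL2Observed (fun t => f t + g t) G h' →
      spectralError a f g h ≤ spectralError a f g h'

/-- The minimality condition. -/
def MinimalityCondition {T : ℕ} (f g : ℝ → Matrix (Fin T) (Fin T) ℂ) : Prop :=
  (∀ᵐ t ∂freqMeasure, IsUnit (f t + g t)) ∧
    Integrable (fun t => ((f t + g t)⁻¹).trace) freqMeasure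

/-! ### Block Toeplitz operators over an index set -/

/-- The block with index `k` generated by the symbol `F`: `(1/2π) ∫ F(t)ᵀ e^{-i k t} dt`. -/
def toeplitzBlock {T : ℕ} (F : ℝ → Matrix (Fin T) (Fin T) ℂ) (k : ℤ) :
    Matrix (Fin T) (Fin T) ℂ :=
  Matrix.of fun ν μ => (1 / (2 * π) : ℂ) * ∫ t, (F t)ᵀ ν μ * expI (-k) t ∂freqMeasure

/-- The blocks `B(k)`, with symbol `(f + g)⁻¹`. -/
def blockB {T : ℕ} (f g : ℝ → Matrix (Fin T) (Fin T) ℂ) : ℤ → Matrix (Fin T) (Fin T) ℂ :=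
  toeplitzBlock fun t => (f t + g t)⁻¹

/-- The blocks `R(k)`, with symbol `f (f + g)⁻¹`. -/
def blockR {T : ℕ} (f g : ℝ → Matrix (Fin T) (Fin T) ℂ) : ℤ → Matrix (Fin T) (Fin T) ℂ :=
  toeplitzBlock fun t => f t * (f t + g t)⁻¹

/-- The blocks `D(k)`, with symbol `f (f + g)⁻¹ g`. -/
def blockD {T : ℕ} (f g : ℝ → Matrix (Fin T) (Fin T) ℂ) : ℤ → Matrix (Fin T) (Fin T) ℂ :=
  toeplitzBlock fun t => f t * (f t + g t)⁻¹ * g t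

/-- `y` is the product of the block matrix `(L(m - n))_{m, n ∈ Γ}` and the vector `x`, every row
sum being convergent. -/
def BlockApply {T : ℕ} (L : ℤ → Matrix (Fin T) (Fin T) ℂ) (Γ : Set ℤ)
    (x y : Γ → Fin T → ℂ) : Prop :=
  ∀ m : Γ, HasSum (fun n : Γ => L (m - n) *ᵥ x n) (y m)

/-- The block matrix `(L(m - n))_{m, n ∈ Γ}` defines an invertible (not necessarily bounded)
linear operator in `ℓ²(Γ; ℂᵀ)`: its columns are square summable, so that the coordinate vectors
belong to the natural domain `{x ∈ ℓ² : L x exists and lies in ℓ²}`, and the operator maps this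
domain bijectively onto `ℓ²(Γ; ℂᵀ)`. -/
structure BlockInvertible {T : ℕ} (L : ℤ → Matrix (Fin T) (Fin T) ℂ) (Γ : Set ℤ) : Prop where
  column_mem : ∀ (n : Γ) (ν : Fin T),
    Memℓp (fun m : Γ => fun μ : Fin T => L (m - n) μ ν) 2
  bijective : ∀ y : Γ → Fin T → ℂ, Memℓp y 2 →
    ∃! x : Γ → Fin T → ℂ, Memℓp x 2 ∧ BlockApply L Γ x y

/-- The scalar product `⟨x, y⟩ = ∑_{n ∈ Γ} x(n)ᵀ conj (y(n))` converges and is equal to `z`. -/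
def HasScalarProduct {T : ℕ} {Γ : Set ℤ} (x y : Γ → Fin T → ℂ) (z : ℂ) : Prop :=
  HasSum (fun n : Γ => x n ⬝ᵥ star (y n)) z

/-- `C(e^{it}) = ∑_{n ∈ Γ} c(n) e^{i n t}`, the series converging in `L²(-π, π)`. -/
def IsFourierSum {T : ℕ} {Γ : Set ℤ} (c : Γ → Fin T → ℂ) (C : ℝ → Fin T → ℂ) : Prop :=
  MemLp C 2 freqMeasure ∧
    Tendsto (fun s : Finset Γ =>
      eLpNorm (fun t => C t - ∑ n ∈ s, expI n t • c n) 2 freqMeasure) atTop (𝓝 0)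

/-- `hᵀ = (Aᵀ f - Cᵀ) (f + g)⁻¹`. -/
def spectralChar {T : ℕ} (a : ℕ → ℂ) (f g : ℝ → Matrix (Fin T) (Fin T) ℂ)
    (C : ℝ → Fin T → ℂ) (t : ℝ) : Fin T → ℂ :=
  (symbolA T a t ᵥ* f t - C t) ᵥ* (f t + g t)⁻¹

end

/-!
The proof identifies all spaces with closed subspaces of `L²((-π, π]; ℂᵀ)` under the normalised
Lebesgue measure, where the functions `e^{i n t} δ_ν` form a Hilbert basis. Write `F = f + g`.

The invertibility of `𝐁` is used twice. First, it forces regularity of the densities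
(`isRegularPair_of_blockInvertible`). Square-summable columns mean that the integrable function
`F⁻¹` has square-summable Fourier coefficients, so `F⁻¹ ∈ L²` (`memLp_symbol_of_column_mem`). The
inverse of `𝐁` is bounded by the closed graph theorem, which for a vector polynomial `p`, moved
into `Γ` by a factor `e^{i N t}`, gives `‖p‖ ≤ M ‖pᵀ F⁻¹‖`. Testing with `p = q v`, where `q` runs
over the scalar polynomials, localises this to `|v| ≤ M |vᵀ F⁻¹|` almost everywhere
(`ae_nonneg_of_integral_normSq_trigPoly`, `exists_lower_bound_symbol`). So `F`, and with it `f` and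
`g`, is bounded, and every product that occurs is square-integrable; in particular `𝐑𝐚 ∈ ℓ²`.

Now let `Q = F^{1/2}`. The map `b ↦ bᵀ Q` turns `L₂(F)` into `L²` (`IsDensitySqrt`), and the
functions `e^{i n t} δ_ν Q` have the Gram matrix of the observed sequence, so that spectral
integrals are limits of the same linear combinations in both spaces (`IsCommonLimit`). Let `η` be
the projection of `Aζ` onto the observations, `w` the corresponding function of `L²`, and
`w₀ = Aᵀ f Q⁻¹`, which correlates with `e^{i n t} δ_ν Q` as `Aζ` does with the observed sequence.
Orthogonality of `Aζ - η` to the observations says that `C = (w₀ - w) Q` has spectrum in `Γ`.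
The functions `e^{i n t} δ_ν Q⁻¹` with `n ∈ Γ` are orthogonal to `w`, and pairing them with
`w₀ - w` gives `𝐁𝐜 = 𝐑𝐚` for the coefficients `𝐜` of `C`. The second use of invertibility is
that this system has no other solution. Hence `w Q⁻¹ = (Aᵀ f - Cᵀ) F⁻¹` is the spectral
characteristic.

The error functional is a constant plus `‖hᵀ Q - w₀‖²` (`spectralError_eq`), so the minimiser is
`w Q⁻¹`, and only that; Parseval's identity (`hasScalarProduct_coeffs`) turns
`‖w₀ - w‖²` into `⟨𝐑𝐚, 𝐜⟩ = ⟨𝐁𝐜, 𝐜⟩` and the constant into `⟨𝐃𝐚, 𝐚⟩`, since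
`f F⁻¹ g = f - f F⁻¹ f`.
-/

/-! ### Fourier uniqueness for integrable functions on `(-π, π]` -/

/-- Lebesgue measure on `(-π, π]`, normalised to total mass one; it absorbs the factors
`1 / (2π)`. -/
noncomputable def normFreq : Measure ℝ := ENNReal.ofReal (1 / (2 * π)) • freqMeasure

lemma freqMeasure_univ : freqMeasure univ = ENNReal.ofReal (2 * π) := by
  simp only [freqMeasure, Measure.restrict_apply_univ, Real.volume_Ioc]
  congr 1; ring

instance : IsProbabilityMeasure normFreq := by
  constructor
  rw [normFreq, Measure.smul_apply, freqMeasure_univ, smul_eq_mul,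
    ← ENNReal.ofReal_mul (by positivity), one_div, inv_mul_cancel₀ (by positivity), ENNReal.ofReal_one]

lemma ofReal_inv_two_pi_ne_zero : ENNReal.ofReal (1 / (2 * π)) ≠ 0 := by
  rw [Ne, ENNReal.ofReal_eq_zero, not_le]; positivity

lemma ae_normFreq_iff {p : ℝ → Prop} : (∀ᵐ t ∂normFreq, p t) ↔ ∀ᵐ t ∂freqMeasure, p t :=
  Measure.ae_ennreal_smul_measure_iff ofReal_inv_two_pi_ne_zero

lemma aestronglyMeasurable_normFreq_iff {β : Type*} [TopologicalSpace β] {b : ℝ → β} :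
    AEStronglyMeasurable b normFreq ↔ AEStronglyMeasurable b freqMeasure := by
  unfold normFreq
  constructor
  · intro h
    refine h.mono_ac ?_
    exact (Measure.AbsolutelyContinuous.refl _).smul_right ofReal_inv_two_pi_ne_zero
  · intro h
    exact h.smul_measure _

lemma integrable_normFreq_iff {E : Type*} [NormedAddCommGroup E] {b : ℝ → E} :
    Integrable b normFreq ↔ Integrable b freqMeasure :=
  integrable_smul_measure ofReal_inv_two_pi_ne_zero ENNReal.ofReal_ne_top

lemma integral_normFreq (φ : ℝ → ℂ) :
    ∫ t, φ t ∂normFreq = (1 / (2 * π) : ℂ) * ∫ t, φ t ∂freqMeasure := by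
  rw [normFreq, integral_smul_measure, ENNReal.toReal_ofReal (by positivity), Complex.real_smul]
  push_cast; rfl

lemma integral_normFreq_real (φ : ℝ → ℝ) :
    ∫ t, φ t ∂normFreq = 1 / (2 * π) * ∫ t, φ t ∂freqMeasure := by
  rw [normFreq, integral_smul_measure, ENNReal.toReal_ofReal (by positivity), smul_eq_mul]

lemma expI_add (m n : ℤ) (t : ℝ) : expI (m + n) t = expI m t * expI n t := by
  simp only [expI, ← Complex.exp_add]; congr 1; push_cast; ring

lemma expI_zero (t : ℝ) : expI 0 t = 1 := by simp [expI]

lemma conj_expI (n : ℤ) (t : ℝ) : conj (expI n t) = expI (-n) t := by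
  simp only [expI, ← Complex.exp_conj]; congr 1; simp

lemma norm_expI (n : ℤ) (t : ℝ) : ‖expI n t‖ = 1 := by
  rw [expI, Complex.norm_exp]; simp

@[fun_prop]
lemma continuous_expI (n : ℤ) : Continuous (expI n) := by
  unfold expI; fun_prop

lemma fourier_eq_expI (n : ℤ) (t : ℝ) : fourier n (t : AddCircle (2 * π)) = expI n t := by
  rw [fourier_coe_apply, expI]
  congr 1
  have : (π : ℂ) ≠ 0 := by exact_mod_cast Real.pi_ne_zero
  push_cast
  field_simp

lemma integral_expI (n : ℤ) : ∫ t, expI n t ∂normFreq = if n = 0 then 1 else 0 := by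
  rw [integral_normFreq]
  have hpi : (π : ℂ) ≠ 0 := by exact_mod_cast Real.pi_ne_zero
  split_ifs with h
  · subst h
    simp only [expI_zero, integral_const, Measure.real, freqMeasure_univ,
      ENNReal.toReal_ofReal (by positivity : 0 ≤ 2 * π), Complex.real_smul]
    push_cast; field_simp
  · have hn : Complex.I * n ≠ 0 := mul_ne_zero Complex.I_ne_zero (by exact_mod_cast h)
    have : ∫ t, expI n t ∂freqMeasure = ∫ t in (-π)..π, Complex.exp (Complex.I * n * t) := by
      rw [intervalIntegral.integral_of_le (by linarith [Real.pi_pos])]; rfl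
    rw [this, integral_exp_mul_complex hn]
    have e : Complex.exp (Complex.I * n * π) = Complex.exp (Complex.I * n * (-π : ℝ)) := by
      rw [Complex.exp_eq_exp_iff_exists_int]
      exact ⟨n, by push_cast; ring⟩
    rw [e]; simp

/-- An integrable real function whose integrals against all `|q|²`, with `q` an analytic
trigonometric polynomial, are nonnegative is nonnegative almost everywhere: the `|q|²` approximate
uniformly the squares of continuous functions on the circle, and these the indicators of compact
sets. -/
lemma ae_nonneg_of_integral_normSq_trigPoly {φ : ℝ → ℝ} (hφ : Integrable φ normFreq)
    (h : ∀ q : ℤ →₀ ℂ, (∀ n ∈ q.support, 0 ≤ n) →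
      0 ≤ ∫ t, ‖q.sum fun n z => z * expI n t‖ ^ 2 * φ t ∂normFreq) :
    ∀ᵐ t ∂normFreq, 0 ≤ φ t := by
  have : Fact (0 < 2 * π) := ⟨by positivity⟩
  have hc : Continuous fun t : ℝ => (t : AddCircle (2 * π)) := AddCircle.continuous_mk' _
  -- all trigonometric polynomials, by a shift of the frequencies
  have h1 : ∀ ψ ∈ Submodule.span ℂ (range (@fourier (2 * π))),
      0 ≤ ∫ t, ‖ψ (t : AddCircle (2 * π))‖ ^ 2 * φ t ∂normFreq := by
    intro ψ hψ
    obtain ⟨q, rfl⟩ := (Finsupp.mem_span_range_iff_exists_finsupp).1 hψ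
    obtain ⟨N, hN⟩ : ∃ N : ℤ, ∀ n ∈ q.support, 0 ≤ n + N := by
      refine ⟨∑ n ∈ q.support, |n|, fun n hn => ?_⟩
      have := Finset.single_le_sum (f := fun n : ℤ => |n|) (fun i _ => abs_nonneg i) hn
      have := neg_abs_le n
      linarith
    have := h (q.mapDomain (· + N)) ?_
    · refine this.trans_eq (integral_congr_ae (.of_forall fun t => ?_))
      simp only
      congr 2
      rw [Finsupp.sum_mapDomain_index (by simp) (by intros; ring)]
      have : (q.sum fun m z => z * expI (m + N) t) = expI N t * q.sum fun m z => z * expI m t := by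
        rw [Finsupp.mul_sum]
        exact Finsupp.sum_congr fun n _ => by rw [expI_add]; ring
      rw [this, norm_mul, norm_expI, one_mul]
      congr 1
      simp [Finsupp.sum, ContinuousMap.sum_apply, fourier_eq_expI, -fourier_apply]
    · intro n hn
      obtain ⟨m, hm, rfl⟩ := Finset.mem_image.1 (Finsupp.mapDomain_support hn)
      exact hN m hm
  -- all continuous functions, by uniform approximation
  have h2 : ∀ ψ : C(AddCircle (2 * π), ℂ),
      0 ≤ ∫ t, ‖ψ (t : AddCircle (2 * π))‖ ^ 2 * φ t ∂normFreq := by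
    intro ψ
    have hψ : ψ ∈ closure (Submodule.span ℂ (range (@fourier (2 * π))) : Set _) := by
      rw [← Submodule.topologicalClosure_coe, span_fourier_closure_eq_top]; trivial
    obtain ⟨p, hp, hlim⟩ := mem_closure_iff_seq_limit.1 hψ
    obtain ⟨R, hR⟩ := hlim.norm.bddAbove_range
    refine ge_of_tendsto' (f := fun n => ∫ t, ‖p n (t : AddCircle (2 * π))‖ ^ 2 * φ t ∂normFreq)
      (x := atTop) ?_ fun n => h1 _ (hp n)
    refine tendsto_integral_of_dominated_convergence (fun t => R ^ 2 * ‖φ t‖) ?_ ?_ ?_ ?_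
    · intro n
      exact (((p n).continuous.comp hc).norm.pow 2).aestronglyMeasurable.mul hφ.1
    · exact hφ.norm.const_mul _
    · intro n
      refine .of_forall fun t => ?_
      rw [norm_mul, norm_pow, norm_norm]
      gcongr
      exact ((p n).norm_coe_le_norm _).trans (hR ⟨n, rfl⟩)
    · refine .of_forall fun t => ?_
      have : Tendsto (fun n => p n (t : AddCircle (2 * π))) atTop (𝓝 (ψ t)) :=
        ((continuous_eval_const (t : AddCircle (2 * π))).tendsto ψ).comp hlim
      exact (this.norm.pow 2).mul_const _
  -- indicators of compact sets
  have h3 : ∀ k ⊆ Ioc (-π) π, IsCompact k → 0 ≤ ∫ t in k, φ t ∂normFreq := by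
    intro k hk hkc
    set k' : Set (AddCircle (2 * π)) := (fun t : ℝ => (t : AddCircle (2 * π))) '' k
    have hk' : IsClosed k' := (hkc.image hc).isClosed
    have hpre : ∀ t ∈ Ioc (-π) π, ((t : AddCircle (2 * π)) ∈ k' ↔ t ∈ k) := by
      intro t ht
      refine ⟨?_, fun h => ⟨t, h, rfl⟩⟩
      rintro ⟨u, hu, hut⟩
      have e : Ioc (-π) π = Ioc (-π) (-π + 2 * π) := by congr 1; ring
      have := (AddCircle.coe_eq_coe_iff_of_mem_Ioc (p := 2 * π) (a := -π)
        (by rw [← e]; exact hk hu) (by rw [← e]; exact ht)).1 hut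
      exact this ▸ hu
    have hδ : ∀ n : ℕ, (0 : ℝ) < 1 / (n + 1) := fun n => Nat.one_div_pos_of_nat
    let ψ : ℕ → C(AddCircle (2 * π), ℂ) := fun n =>
      ⟨fun x => ((thickenedIndicator (hδ n) k' x : ℝ) : ℂ), by fun_prop⟩
    have hψ : ∀ n x, ‖ψ n x‖ ≤ 1 := fun n x => by
      simp only [ψ, ContinuousMap.coe_mk, Complex.norm_real, NNReal.norm_eq]
      exact_mod_cast thickenedIndicator_le_one (hδ n) k' x
    rw [← integral_indicator hkc.measurableSet]
    refine ge_of_tendsto' (f := fun n => ∫ t, ‖ψ n (t : AddCircle (2 * π))‖ ^ 2 * φ t ∂normFreq)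
      (x := atTop) ?_ fun n => h2 _
    refine tendsto_integral_of_dominated_convergence (fun t => ‖φ t‖) ?_ hφ.norm ?_ ?_
    · intro n
      exact (((ψ n).continuous.comp hc).norm.pow 2).aestronglyMeasurable.mul hφ.1
    · intro n
      refine .of_forall fun t => ?_
      rw [norm_mul, norm_pow, norm_norm]
      exact mul_le_of_le_one_left (norm_nonneg _) (pow_le_one₀ (norm_nonneg _) (hψ n _))
    · rw [ae_normFreq_iff]
      filter_upwards [ae_restrict_mem (measurableSet_Ioc : MeasurableSet (Ioc (-π) π))] with t ht
      have := tendsto_pi_nhds.1 (thickenedIndicator_tendsto_indicator_closure hδ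
        tendsto_one_div_add_atTop_nhds_zero_nat k') (t : AddCircle (2 * π))
      rw [hk'.closure_eq] at this
      have h4 : Tendsto (fun n => ‖ψ n (t : AddCircle (2 * π))‖ ^ 2 * φ t) atTop
          (𝓝 (((k'.indicator (fun _ => (1 : NNReal)) (t : AddCircle (2 * π)) : NNReal) : ℝ) ^ 2
            * φ t)) := by
        refine Tendsto.mul_const _ (Tendsto.pow ?_ 2)
        simp only [ψ, ContinuousMap.coe_mk, Complex.norm_real, NNReal.norm_eq]
        exact (NNReal.tendsto_coe.2 this)
      convert h4 using 2
      by_cases htk : t ∈ k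
      · simp [htk, (hpre t ht).2 htk]
      · simp [htk, mt (hpre t ht).1 htk]
  -- inner regularity
  obtain ⟨φ', hφ'm, hφ'⟩ := hφ.1
  have hmeas : MeasurableSet ({t | φ' t < 0} ∩ Ioc (-π) π) :=
    (hφ'm.measurable measurableSet_Iio).inter measurableSet_Ioc
  have hzero : volume ({t | φ' t < 0} ∩ Ioc (-π) π) = 0 := by
    by_contra hne
    obtain ⟨k, hk, hkc, hpos⟩ := hmeas.exists_lt_isCompact (pos_iff_ne_zero.2 hne)
    have hsub : k ⊆ Ioc (-π) π := fun t ht => (hk ht).2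
    have h5 := h3 k hsub hkc
    have e : ∫ t in k, φ t ∂normFreq = ∫ t in k, φ' t ∂normFreq :=
      integral_congr_ae (ae_restrict_of_ae hφ')
    have hnk : normFreq k ≠ 0 := by
      rw [normFreq, Measure.smul_apply, smul_eq_mul, freqMeasure,
        Measure.restrict_eq_self _ hsub]
      exact mul_ne_zero ofReal_inv_two_pi_ne_zero hpos.ne'
    have h6 : 0 < ∫ t in k, -φ' t ∂normFreq := by
      rw [setIntegral_pos_iff_support_of_nonneg_ae]
      · refine pos_iff_ne_zero.2 fun h0 => hnk ?_
        refine measure_mono_null ?_ h0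
        exact fun t ht => ⟨by simpa using (hk ht).1.ne, ht⟩
      · exact (ae_restrict_mem hkc.measurableSet).mono fun t ht => by
          have := (hk ht).1; simp only [mem_ofPred_eq] at this; simp; linarith
      · exact ((hφ.congr hφ').neg).integrableOn
    rw [integral_neg, ← e] at h6
    linarith
  have h7 : ∀ᵐ t ∂normFreq, t ∉ {t | φ' t < 0} ∩ Ioc (-π) π := by
    rw [ae_normFreq_iff]
    exact ae_restrict_of_ae (measure_eq_zero_iff_ae_notMem.1 hzero)
  have h8 : ∀ᵐ t ∂normFreq, t ∈ Ioc (-π) π := by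
    rw [ae_normFreq_iff]; exact ae_restrict_mem measurableSet_Ioc
  filter_upwards [h7, h8, hφ'] with t ht ht' e
  rw [e]
  by_contra hlt
  exact ht ⟨not_le.1 hlt, ht'⟩

/-- An integrable function all of whose Fourier coefficients vanish is zero almost everywhere. -/
lemma ae_eq_zero_of_fourier_eq_zero {φ : ℝ → ℂ} (hφ : Integrable φ normFreq)
    (h : ∀ n : ℤ, ∫ t, φ t * expI (-n) t ∂normFreq = 0) : φ =ᵐ[normFreq] 0 := by
  have hi : ∀ n : ℤ, Integrable (fun t => φ t * expI n t) normFreq := fun n =>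
    hφ.mul_bdd (c := 1) (continuous_expI n).aestronglyMeasurable
      (.of_forall fun t => (norm_expI n t).le)
  have key : ∀ q : ℤ →₀ ℂ,
      ∫ t, ((‖q.sum fun n z => z * expI n t‖ ^ 2 : ℝ) : ℂ) * φ t ∂normFreq = 0 := by
    intro q
    have e : ∀ t, ((‖q.sum fun n z => z * expI n t‖ ^ 2 : ℝ) : ℂ) * φ t =
        ∑ m ∈ q.support, ∑ n ∈ q.support, (q m * conj (q n)) * (φ t * expI (m - n) t) := by
      intro t
      have : ((‖q.sum fun n z => z * expI n t‖ ^ 2 : ℝ) : ℂ) =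
        (q.sum fun n z => z * expI n t) * conj (q.sum fun n z => z * expI n t) := by
        rw [Complex.mul_conj, Complex.normSq_eq_norm_sq]
      rw [this]
      simp only [Finsupp.sum, map_sum, map_mul, conj_expI, sub_eq_add_neg, expI_add]
      rw [Finset.sum_mul_sum, Finset.sum_mul]
      simp only [Finset.sum_mul]
      refine Finset.sum_congr rfl fun m _ => Finset.sum_congr rfl fun n _ => ?_
      ring
    simp only [e]
    rw [integral_finsetSum _ fun m _ => integrable_finsetSum _ fun n _ => (hi _).const_mul _]
    refine Finset.sum_eq_zero fun m _ => ?_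
    rw [integral_finsetSum _ fun n _ => (hi _).const_mul _]
    refine Finset.sum_eq_zero fun n _ => ?_
    rw [integral_const_mul]
    have := h (n - m)
    rw [neg_sub] at this
    rw [this, mul_zero]
  have hq : ∀ q : ℤ →₀ ℂ, Integrable
      (fun t => ((‖q.sum fun n z => z * expI n t‖ ^ 2 : ℝ) : ℂ) * φ t) normFreq := by
    intro q
    refine hφ.bdd_mul (c := (∑ n ∈ q.support, ‖q n‖) ^ 2) ?_ (.of_forall fun t => ?_)
    · unfold Finsupp.sum
      exact Continuous.aestronglyMeasurable (by fun_prop)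
    · rw [Complex.norm_real, norm_pow, norm_norm]
      gcongr
      refine (norm_sum_le _ _).trans_eq (Finset.sum_congr rfl fun n _ => ?_)
      rw [norm_mul, norm_expI, mul_one]
  have hre : ∀ q : ℤ →₀ ℂ, ∫ t, ‖q.sum fun n z => z * expI n t‖ ^ 2 * (φ t).re ∂normFreq = 0 := by
    intro q
    have := integral_re (hq q)
    rw [show (∫ t, ((‖q.sum fun n z => z * expI n t‖ ^ 2 : ℝ) : ℂ) * φ t ∂normFreq) = 0 from key q]
      at this
    simpa only [RCLike.re_to_complex, Complex.re_ofReal_mul, map_zero] using this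
  have him : ∀ q : ℤ →₀ ℂ, ∫ t, ‖q.sum fun n z => z * expI n t‖ ^ 2 * (φ t).im ∂normFreq = 0 := by
    intro q
    have := integral_im (hq q)
    rw [show (∫ t, ((‖q.sum fun n z => z * expI n t‖ ^ 2 : ℝ) : ℂ) * φ t ∂normFreq) = 0 from key q]
      at this
    simpa only [RCLike.im_to_complex, Complex.im_ofReal_mul, map_zero] using this
  have a1 := ae_nonneg_of_integral_normSq_trigPoly hφ.re fun q _ => (hre q).ge
  have a2 := ae_nonneg_of_integral_normSq_trigPoly hφ.re.neg fun q _ => by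
    simp only [Pi.neg_apply, mul_neg, integral_neg]; exact (neg_eq_zero.2 (hre q)).ge
  have a3 := ae_nonneg_of_integral_normSq_trigPoly hφ.im fun q _ => (him q).ge
  have a4 := ae_nonneg_of_integral_normSq_trigPoly hφ.im.neg fun q _ => by
    simp only [Pi.neg_apply, mul_neg, integral_neg]; exact (neg_eq_zero.2 (him q)).ge
  filter_upwards [a1, a2, a3, a4] with t h1 h2 h3 h4
  simp only [Pi.neg_apply, RCLike.re_to_complex, RCLike.im_to_complex] at h1 h2 h3 h4
  exact Complex.ext (by simp; linarith) (by simp; linarith)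

/-! ### Square-integrable vector functions and their Fourier coefficients -/

section VectorFunctions

variable {T : ℕ}

/-- The Hilbert space of square-integrable `ℂᵀ`-valued functions on `(-π, π]`. -/
noncomputable abbrev L2Vec (T : ℕ) := Lp (EuclideanSpace ℂ (Fin T)) 2 normFreq

lemma memLp_toLp {b : ℝ → Fin T → ℂ} (hb : MemLp b 2 normFreq) :
    MemLp (fun t => WithLp.toLp 2 (b t)) 2 normFreq :=
  memLp_piLp_iff.2 fun i => memLp_pi_iff.1 hb i

/-- The class in `L2Vec T` of a square-integrable function. -/
noncomputable def toVec (b : ℝ → Fin T → ℂ) (hb : MemLp b 2 normFreq) : L2Vec T :=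
  (memLp_toLp hb).toLp _

lemma coeFn_toVec {b : ℝ → Fin T → ℂ} (hb : MemLp b 2 normFreq) :
    ∀ᵐ t ∂normFreq, (toVec b hb) t = WithLp.toLp 2 (b t) :=
  (memLp_toLp hb).coeFn_toLp

lemma toVec_eq_iff {b b' : ℝ → Fin T → ℂ} (hb : MemLp b 2 normFreq) (hb' : MemLp b' 2 normFreq) :
    toVec b hb = toVec b' hb' ↔ b =ᵐ[normFreq] b' := by
  rw [toVec, toVec, MemLp.toLp_eq_toLp_iff]
  constructor <;> intro h <;> filter_upwards [h] with t ht
  · exact WithLp.toLp_injective 2 ht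
  · rw [ht]

lemma exists_toVec (x : L2Vec T) : ∃ b hb, toVec (T := T) b hb = x := by
  have hx := Lp.memLp x
  have hb : MemLp (fun t => WithLp.ofLp (x t)) 2 normFreq :=
    memLp_pi_iff.2 fun i => memLp_piLp_iff.1 hx i
  refine ⟨_, hb, ?_⟩
  exact Lp.toLp_coeFn x hx

lemma toVec_sub {b b' : ℝ → Fin T → ℂ} (hb : MemLp b 2 normFreq) (hb' : MemLp b' 2 normFreq) :
    toVec b hb - toVec b' hb' = toVec (fun t => b t - b' t) (hb.sub hb') := by
  rw [toVec, toVec, ← MemLp.toLp_sub]; rfl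

lemma inner_toVec {b b' : ℝ → Fin T → ℂ} (hb : MemLp b 2 normFreq) (hb' : MemLp b' 2 normFreq) :
    inner ℂ (toVec b hb) (toVec b' hb') = ∫ t, b' t ⬝ᵥ star (b t) ∂normFreq := by
  rw [L2.inner_def]
  refine integral_congr_ae ?_
  filter_upwards [coeFn_toVec hb, coeFn_toVec hb'] with t h h'
  rw [h, h', EuclideanSpace.inner_toLp_toLp]

lemma integrable_dotProduct_star {b b' : ℝ → Fin T → ℂ} (hb : MemLp b 2 normFreq)
    (hb' : MemLp b' 2 normFreq) : Integrable (fun t => b' t ⬝ᵥ star (b t)) normFreq := by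
  refine (L2.integrable_inner (𝕜 := ℂ) (toVec b hb) (toVec b' hb')).congr ?_
  filter_upwards [coeFn_toVec hb, coeFn_toVec hb'] with t h h'
  rw [h, h', EuclideanSpace.inner_toLp_toLp]

lemma norm_sq_toVec {b : ℝ → Fin T → ℂ} (hb : MemLp b 2 normFreq) :
    ‖toVec b hb‖ ^ 2 = ∫ t, (b t ⬝ᵥ star (b t)).re ∂normFreq := by
  rw [← inner_self_eq_norm_sq (𝕜 := ℂ), inner_toVec]
  exact (integral_re (integrable_dotProduct_star hb hb)).symm

lemma memLp_vecMul {p q r : ℝ≥0∞} [ENNReal.HolderTriple p q r] {b : ℝ → Fin T → ℂ}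
    {M : ℝ → Matrix (Fin T) (Fin T) ℂ} (hb : MemLp b p normFreq)
    (hM : ∀ i j, MemLp (fun t => M t i j) q normFreq) :
    MemLp (fun t => b t ᵥ* M t) r normFreq := by
  refine memLp_pi_iff.2 fun j => ?_
  simp only [Matrix.vecMul, dotProduct]
  exact memLp_finsetSum _ fun i _ => (hM i j).mul (memLp_pi_iff.1 hb i)

lemma memLp_matrix_mul {p q r : ℝ≥0∞} [ENNReal.HolderTriple p q r]
    {M M' : ℝ → Matrix (Fin T) (Fin T) ℂ} (hM : ∀ i j, MemLp (fun t => M t i j) p normFreq)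
    (hM' : ∀ i j, MemLp (fun t => M' t i j) q normFreq) (i j : Fin T) :
    MemLp (fun t => (M t * M' t) i j) r normFreq := by
  simp only [Matrix.mul_apply]
  exact memLp_finsetSum _ fun k _ => (hM' k j).mul (hM i k)

lemma linearCombination_toVec {ι : Type*} {b : ι → ℝ → Fin T → ℂ}
    (hb : ∀ k, MemLp (b k) 2 normFreq) (p : ι →₀ ℂ) :
    ∃ h : MemLp (fun t => p.sum fun k z => z • b k t) 2 normFreq,
      Finsupp.linearCombination ℂ (fun k => toVec (b k) (hb k)) p = toVec _ h := by
  classical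
  induction p using Finsupp.induction_linear with
  | zero =>
    simp only [Finsupp.sum_zero_index, map_zero]
    exact ⟨MemLp.zero' , ((MemLp.toLp_zero _)).symm⟩
  | add p q hp hq =>
    obtain ⟨h1, e1⟩ := hp
    obtain ⟨h2, e2⟩ := hq
    have e : (fun t => (p + q).sum fun k z => z • b k t) =
        fun t => (p.sum fun k z => z • b k t) + q.sum fun k z => z • b k t := by
      funext t
      exact Finsupp.sum_add_index' (by simp) (by intros; rw [add_smul])
    rw [e]
    refine ⟨h1.add h2, ?_⟩
    rw [map_add, e1, e2]
    exact ((memLp_toLp h1).toLp_add (memLp_toLp h2)).symm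
  | single k z =>
    have e : (fun t => (Finsupp.single k z).sum fun k z => z • b k t) = fun t => z • b k t := by
      funext t; exact Finsupp.sum_single_index (by simp)
    rw [e]
    refine ⟨(hb k).const_smul z, ?_⟩
    rw [Finsupp.linearCombination_single]
    exact (MemLp.toLp_const_smul z (memLp_toLp (hb k))).symm

/-- The function `e^{i n t} δ_ν` with `k = (n, ν)`. -/
noncomputable def expVec (k : ℤ × Fin T) (t : ℝ) : Fin T → ℂ := Pi.single k.2 (expI k.1 t)

lemma continuous_expVec (k : ℤ × Fin T) : Continuous (expVec k) := by
  refine continuous_pi fun ν => ?_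
  by_cases h : ν = k.2
  · subst h; simpa [expVec] using continuous_expI k.1
  · simpa [expVec, h] using continuous_const

lemma memLp_top_expVec (k : ℤ × Fin T) : MemLp (expVec k) ∞ normFreq := by
  refine memLp_top_of_bound (continuous_expVec k).aestronglyMeasurable 1 (.of_forall fun t => ?_)
  refine (pi_norm_le_iff_of_nonneg zero_le_one).2 fun ν => ?_
  by_cases h : ν = k.2
  · subst h; simp [expVec, norm_expI]
  · simp [expVec, h]

lemma memLp_expVec (k : ℤ × Fin T) : MemLp (expVec k) 2 normFreq :=
  (memLp_top_expVec k).mono_exponent le_top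

lemma dotProduct_star_expVec (b : Fin T → ℂ) (k : ℤ × Fin T) (t : ℝ) :
    b ⬝ᵥ star (expVec k t) = b k.2 * expI (-k.1) t := by
  rw [expVec, ← conj_expI, ← Pi.single_star, dotProduct_single]; rfl

lemma trigPoly_eq (p : (ℤ × Fin T) →₀ ℂ) (t : ℝ) :
    trigPoly p t = p.sum fun k z => z • expVec k t := by
  refine Finsupp.sum_congr fun k _ => ?_
  rw [mul_smul, expVec, ← Pi.single_smul', smul_eq_mul, mul_one]

/-- `e^{i n t} δ_ν` as an element of `L2Vec T`. -/
noncomputable def expL2 (k : ℤ × Fin T) : L2Vec T := toVec (expVec k) (memLp_expVec k)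

lemma inner_expL2_toVec (k : ℤ × Fin T) {b : ℝ → Fin T → ℂ} (hb : MemLp b 2 normFreq) :
    inner ℂ (expL2 k) (toVec b hb) = ∫ t, b t k.2 * expI (-k.1) t ∂normFreq := by
  rw [expL2, inner_toVec]
  simp only [dotProduct_star_expVec]

lemma orthonormal_expL2 : Orthonormal ℂ (expL2 (T := T)) := by
  rw [orthonormal_iff_ite]
  intro k l
  rw [expL2.eq_def l, inner_expL2_toVec]
  by_cases h : l.2 = k.2
  · have : ∀ t, expVec l t k.2 * expI (-k.1) t = expI (l.1 + -k.1) t := fun t => by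
      rw [expVec, h, Pi.single_eq_same, expI_add]
    simp only [this, integral_expI]
    refine if_congr ?_ rfl rfl
    rw [Prod.ext_iff, ← h]
    constructor
    · intro h'; exact ⟨by lia, rfl⟩
    · rintro ⟨h', -⟩; lia
  · have : ∀ t, expVec l t k.2 * expI (-k.1) t = 0 := fun t => by
      rw [expVec, Pi.single_eq_of_ne (Ne.symm h), zero_mul]
    simp only [this, integral_zero]
    rw [if_neg fun e => h (by rw [e])]

/-- The exponentials form a Hilbert basis. -/
noncomputable def expBasis (T : ℕ) : HilbertBasis (ℤ × Fin T) ℂ (L2Vec T) :=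
  HilbertBasis.mkOfOrthogonalEqBot orthonormal_expL2 <| by
    rw [Submodule.eq_bot_iff]
    intro x hx
    obtain ⟨b, hb, rfl⟩ := exists_toVec x
    have h0 : toVec (fun _ => (0 : Fin T → ℂ)) MemLp.zero' = (0 : L2Vec T) := MemLp.toLp_zero _
    rw [← h0, toVec_eq_iff]
    have : ∀ ν, (fun t => b t ν) =ᵐ[normFreq] 0 := fun ν =>
      ae_eq_zero_of_fourier_eq_zero ((memLp_pi_iff.1 hb ν).integrable (by norm_num)) fun n => by
        rw [← inner_expL2_toVec (n, ν) hb]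
        exact hx _ (Submodule.subset_span ⟨_, rfl⟩)
    filter_upwards [ae_all_iff.2 this] with t ht
    exact funext ht

lemma coe_expBasis : ⇑(expBasis T) = expL2 := HilbertBasis.coe_mkOfOrthogonalEqBot _ _

lemma ext_inner_expL2 {x y : L2Vec T} (h : ∀ k, inner ℂ (expL2 k) x = inner ℂ (expL2 k) y) :
    x = y := by
  apply (expBasis T).repr.injective
  ext k
  rw [HilbertBasis.repr_apply_apply, HilbertBasis.repr_apply_apply, coe_expBasis, h]

lemma exists_inner_expL2_eq (z : ℤ × Fin T → ℂ) (hz : Summable fun k => ‖z k‖ ^ 2) :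
    ∃ x : L2Vec T, ∀ k, inner ℂ (expL2 k) x = z k := by
  have hz' : Memℓp z 2 := memℓp_gen (by simpa using hz)
  refine ⟨(expBasis T).repr.symm ⟨z, hz'⟩, fun k => ?_⟩
  rw [← coe_expBasis, ← HilbertBasis.repr_apply_apply, LinearIsometryEquiv.apply_symm_apply]

/-- An integrable function with square-summable Fourier coefficients is square-integrable. -/
lemma memLp_two_of_summable_fourier {b : ℝ → Fin T → ℂ}
    (hb : ∀ ν, Integrable (fun t => b t ν) normFreq)
    (hs : Summable fun k : ℤ × Fin T => ‖∫ t, b t k.2 * expI (-k.1) t ∂normFreq‖ ^ 2) :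
    MemLp b 2 normFreq := by
  obtain ⟨x, hx⟩ := exists_inner_expL2_eq _ hs
  obtain ⟨b', hb', rfl⟩ := exists_toVec x
  refine hb'.ae_eq ?_
  have hi : ∀ {φ : ℝ → ℂ} (n : ℤ), Integrable φ normFreq →
      Integrable (fun t => φ t * expI n t) normFreq := fun n h =>
    h.mul_bdd (c := 1) (continuous_expI n).aestronglyMeasurable
      (.of_forall fun t => (norm_expI n t).le)
  have hbi : ∀ ν, Integrable (fun t => b' t ν) normFreq := fun ν =>
    (memLp_pi_iff.1 hb' ν).integrable (by norm_num)
  have : ∀ ν, (fun t => b' t ν - b t ν) =ᵐ[normFreq] 0 := fun ν =>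
    ae_eq_zero_of_fourier_eq_zero ((hbi ν).sub (hb ν)) fun n => by
      simp only [sub_mul]
      rw [integral_sub (hi _ (hbi ν)) (hi _ (hb ν)), ← inner_expL2_toVec (n, ν) hb', hx, sub_self]
  filter_upwards [ae_all_iff.2 this] with t ht
  exact funext fun ν => sub_eq_zero.1 (ht ν)

/-! ### Functions with spectrum in a set of frequencies -/

/-- The functions whose Fourier coefficients vanish off `Γ`. -/
noncomputable def freqSubspace (T : ℕ) (Γ : Set ℤ) : Submodule ℂ (L2Vec T) :=
  (Submodule.span ℂ (expL2 '' {k | k.1 ∉ Γ}))ᗮ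

lemma mem_freqSubspace {Γ : Set ℤ} {x : L2Vec T} :
    x ∈ freqSubspace T Γ ↔ ∀ k, k.1 ∉ Γ → inner ℂ (expL2 k) x = 0 := by
  constructor
  · intro h k hk
    exact (Submodule.mem_orthogonal _ _).1 h _ (Submodule.subset_span ⟨k, hk, rfl⟩)
  · intro h
    rw [freqSubspace, Submodule.mem_orthogonal]
    intro u hu
    induction hu using Submodule.span_induction with
    | mem u hu => obtain ⟨k, hk, rfl⟩ := hu; exact h k hk
    | zero => exact inner_zero_left _
    | add u v _ _ hu hv => rw [inner_add_left, hu, hv, add_zero]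
    | smul z u _ hu => rw [inner_smul_left, hu, mul_zero]

lemma expL2_mem_freqSubspace {Γ : Set ℤ} {k : ℤ × Fin T} (hk : k.1 ∈ Γ) :
    expL2 k ∈ freqSubspace T Γ := by
  rw [mem_freqSubspace]
  intro l hl
  exact orthonormal_expL2.2 fun e => hl (by rw [e]; exact hk)

/-- The Fourier coefficients with indices in `Γ`. -/
noncomputable def coeffs (Γ : Set ℤ) (x : L2Vec T) (n : Γ) (ν : Fin T) : ℂ :=
  inner ℂ (expL2 ((n : ℤ), ν)) x

lemma memℓp_two_iff {ι : Type*} {x : ι → Fin T → ℂ} :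
    Memℓp x 2 ↔ Summable fun k : ι × Fin T => ‖x k.1 k.2‖ ^ 2 := by
  rw [memℓp_gen_iff (by norm_num)]
  simp only [ENNReal.toReal_ofNat, Real.rpow_ofNat]
  constructor
  · intro h
    rw [summable_prod_of_nonneg fun _ => by positivity]
    refine ⟨fun n => (hasSum_fintype _).summable, ?_⟩
    simp only [tsum_fintype]
    refine Summable.of_nonneg_of_le (fun n => by positivity) (fun n => ?_) (h.mul_left (T : ℝ))
    calc ∑ ν, ‖x n ν‖ ^ 2 ≤ ∑ _ν : Fin T, ‖x n‖ ^ 2 := by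
          gcongr with ν; exact norm_le_pi_norm _ _
      _ = T * ‖x n‖ ^ 2 := by simp
  · intro h
    have h2 := ((summable_prod_of_nonneg fun _ => by positivity).1 h).2
    simp only [tsum_fintype] at h2
    refine Summable.of_nonneg_of_le (fun n => by positivity) (fun n => ?_) h2
    have : ‖x n‖ ≤ √(∑ ν, ‖x n ν‖ ^ 2) := by
      refine (pi_norm_le_iff_of_nonneg (by positivity)).2 fun ν => ?_
      refine Real.le_sqrt_of_sq_le ?_
      exact Finset.single_le_sum (f := fun ν => ‖x n ν‖ ^ 2) (fun _ _ => by positivity)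
        (Finset.mem_univ ν)
    calc ‖x n‖ ^ 2 ≤ √(∑ ν, ‖x n ν‖ ^ 2) ^ 2 := by gcongr
      _ = _ := Real.sq_sqrt (by positivity)

lemma memℓp_coeffs (Γ : Set ℤ) (x : L2Vec T) : Memℓp (coeffs Γ x) 2 := by
  rw [memℓp_two_iff]
  have := (orthonormal_expL2 (T := T)).inner_products_summable (x := x)
  exact this.comp_injective (i := fun k : Γ × Fin T => ((k.1 : ℤ), k.2)) fun k l h => by
    simp only [Prod.mk.injEq] at h
    exact Prod.ext (Subtype.ext h.1) h.2

lemma exists_coeffs_eq {Γ : Set ℤ} {x : Γ → Fin T → ℂ} (hx : Memℓp x 2) :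
    ∃ y ∈ freqSubspace T Γ, coeffs Γ y = x := by
  classical
  let i : Γ × Fin T → ℤ × Fin T := fun k => ((k.1 : ℤ), k.2)
  have hi : Function.Injective i := fun k l h => by
    simp only [i, Prod.mk.injEq] at h
    exact Prod.ext (Subtype.ext h.1) h.2
  let z : ℤ × Fin T → ℂ := Function.extend i (fun k => x k.1 k.2) 0
  have hz : Summable fun k => ‖z k‖ ^ 2 := by
    have h0 : ∀ k ∉ range i, ‖z k‖ ^ 2 = 0 := fun k hk => by
      simp only [z, Function.extend_apply' _ _ _ hk, Pi.zero_apply, norm_zero]; norm_num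
    rw [← hi.summable_iff h0]
    refine (memℓp_two_iff.1 hx).congr fun k => ?_
    simp [z, hi.extend_apply]
  obtain ⟨y, hy⟩ := exists_inner_expL2_eq z hz
  refine ⟨y, mem_freqSubspace.2 fun k hk => ?_, ?_⟩
  · rw [hy]
    refine Function.extend_apply' _ _ _ ?_
    rintro ⟨l, rfl⟩
    exact hk l.1.2
  · funext n ν
    rw [coeffs, hy]
    exact hi.extend_apply (fun k => x k.1 k.2) 0 (n, ν)

lemma coeffs_injOn {Γ : Set ℤ} {x y : L2Vec T} (hx : x ∈ freqSubspace T Γ)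
    (hy : y ∈ freqSubspace T Γ) (h : coeffs Γ x = coeffs Γ y) : x = y := by
  refine ext_inner_expL2 fun k => ?_
  by_cases hk : k.1 ∈ Γ
  · exact congrFun (congrFun h ⟨k.1, hk⟩) k.2
  · rw [mem_freqSubspace.1 hx k hk, mem_freqSubspace.1 hy k hk]

lemma hasSum_coeffs {Γ : Set ℤ} {x : L2Vec T} (hx : x ∈ freqSubspace T Γ) :
    HasSum (fun n : Γ => ∑ ν, coeffs Γ x n ν • expL2 ((n : ℤ), ν)) x := by
  have h := (expBasis T).hasSum_repr x
  simp only [HilbertBasis.repr_apply_apply, coe_expBasis] at h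
  have h2 := h.prod_fiberwise fun n => hasSum_fintype _
  exact (hasSum_subtype_iff_of_support_subset
    (f := fun n : ℤ => ∑ ν : Fin T, (inner ℂ (expL2 (n, ν)) x : ℂ) • expL2 (n, ν)) (s := Γ) (by
      intro n hn
      by_contra hnΓ
      refine hn (Finset.sum_eq_zero fun ν _ => ?_)
      rw [mem_freqSubspace.1 hx (n, ν) hnΓ, zero_smul])).2 h2

/-- Parseval's identity. -/
lemma hasScalarProduct_coeffs {Γ : Set ℤ} {x : L2Vec T} (hx : x ∈ freqSubspace T Γ)
    (y : L2Vec T) : HasScalarProduct (coeffs Γ y) (coeffs Γ x) (inner ℂ x y) := by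
  have h := (hasSum_coeffs hx).mapL (innerSL ℂ y)
  have h2 := (Complex.hasSum_conj'.2 h)
  simp only [innerSL_apply_apply, inner_conj_symm] at h2
  refine (congrArg (HasSum · _) (funext fun n => ?_)).mp h2
  rw [sum_inner]
  refine Finset.sum_congr rfl fun ν _ => ?_
  rw [inner_smul_left, mul_comm]
  rfl

end VectorFunctions

/-! ### Block Toeplitz matrices as operators -/

section Toeplitz

variable {T : ℕ}

lemma toeplitzBlock_apply (G : ℝ → Matrix (Fin T) (Fin T) ℂ) (k : ℤ) (ν μ : Fin T) :
    toeplitzBlock G k ν μ = ∫ t, G t μ ν * expI (-k) t ∂normFreq := by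
  rw [integral_normFreq]; rfl

lemma vecMul_dotProduct_star (x y : Fin T → ℂ) (M : Matrix (Fin T) (Fin T) ℂ) :
    (x ᵥ* M) ⬝ᵥ star y = x ⬝ᵥ star (y ᵥ* Mᴴ) := by
  rw [Matrix.star_vecMul, Matrix.conjTranspose_conjTranspose, Matrix.dotProduct_mulVec]

lemma memLp_conjTranspose {p : ℝ≥0∞} {G : ℝ → Matrix (Fin T) (Fin T) ℂ}
    (hG : ∀ i j, MemLp (fun t => G t i j) p normFreq) (i j : Fin T) :
    MemLp (fun t => (G t)ᴴ i j) p normFreq := (hG j i).star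

lemma memLp_expVec_vecMul {G : ℝ → Matrix (Fin T) (Fin T) ℂ}
    (hG : ∀ i j, MemLp (fun t => G t i j) 2 normFreq) (k : ℤ × Fin T) :
    MemLp (fun t => expVec k t ᵥ* G t) 2 normFreq :=
  memLp_vecMul (p := ∞) (memLp_top_expVec k) hG

/-- `e^{i n t} δ_ν Gᴴ`: pairing with it gives the row `(n, ν)` of the block Toeplitz matrix with
symbol `G`. -/
noncomputable def toeplitzRow (G : ℝ → Matrix (Fin T) (Fin T) ℂ)
    (hG : ∀ i j, MemLp (fun t => G t i j) 2 normFreq) (k : ℤ × Fin T) : L2Vec T :=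
  toVec (fun t => expVec k t ᵥ* (G t)ᴴ) (memLp_expVec_vecMul (memLp_conjTranspose hG) k)

lemma inner_toeplitzRow {G : ℝ → Matrix (Fin T) (Fin T) ℂ}
    (hG : ∀ i j, MemLp (fun t => G t i j) 2 normFreq) (k : ℤ × Fin T) {b : ℝ → Fin T → ℂ}
    (hb : MemLp b 2 normFreq) :
    inner ℂ (toeplitzRow G hG k) (toVec b hb) =
      ∫ t, (b t ᵥ* G t) k.2 * expI (-k.1) t ∂normFreq := by
  rw [toeplitzRow, inner_toVec]
  simp only [← vecMul_dotProduct_star, dotProduct_star_expVec]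

lemma inner_toeplitzRow_expL2 {G : ℝ → Matrix (Fin T) (Fin T) ℂ}
    (hG : ∀ i j, MemLp (fun t => G t i j) 2 normFreq) (k l : ℤ × Fin T) :
    inner ℂ (toeplitzRow G hG k) (expL2 l) = toeplitzBlock G (k.1 - l.1) k.2 l.2 := by
  rw [expL2, inner_toeplitzRow, toeplitzBlock_apply]
  refine integral_congr_ae (.of_forall fun t => ?_)
  simp only [expVec, Matrix.single_vecMul, Pi.smul_apply, Matrix.row_apply, smul_eq_mul]
  rw [show -(k.1 - l.1) = l.1 + -k.1 by ring, expI_add]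
  ring

lemma blockApply_coeffs {G : ℝ → Matrix (Fin T) (Fin T) ℂ}
    (hG : ∀ i j, MemLp (fun t => G t i j) 2 normFreq) {Γ : Set ℤ} {x : L2Vec T}
    (hx : x ∈ freqSubspace T Γ) :
    BlockApply (toeplitzBlock G) Γ (coeffs Γ x)
      (fun m ν => inner ℂ (toeplitzRow G hG ((m : ℤ), ν)) x) := by
  intro m
  rw [Pi.hasSum]
  intro ν
  have h := (hasSum_coeffs hx).mapL (innerSL ℂ (toeplitzRow G hG ((m : ℤ), ν)))
  simp only [innerSL_apply_apply] at h
  refine h.congr_fun fun n => ?_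
  rw [inner_sum, Matrix.mulVec, dotProduct]
  refine Finset.sum_congr rfl fun μ _ => ?_
  rw [inner_smul_right, inner_toeplitzRow_expL2, mul_comm]

lemma blockApply_unique {L : ℤ → Matrix (Fin T) (Fin T) ℂ} {Γ : Set ℤ} {x y y' : Γ → Fin T → ℂ}
    (h : BlockApply L Γ x y) (h' : BlockApply L Γ x y') : y = y' :=
  funext fun m => (h m).unique (h' m)

/-- The closed graph theorem for an equation `⟨g i, x⟩ = ⟨e i, y⟩` that is uniquely solvable for
`x` in a closed subspace. -/
lemma exists_bound_of_existsUnique {E ι : Type*} [NormedAddCommGroup E] [InnerProductSpace ℂ E]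
    [CompleteSpace E] (K : Submodule ℂ E) (hK : IsClosed (K : Set E)) (e g : ι → E)
    (h : ∀ y ∈ K, ∃! x, x ∈ K ∧ ∀ i, inner ℂ (g i) x = inner ℂ (e i) y) :
    ∃ M : ℝ, ∀ x ∈ K, ∀ y ∈ K, (∀ i, inner ℂ (g i) x = inner ℂ (e i) y) → ‖x‖ ≤ M * ‖y‖ := by
  have : CompleteSpace K := hK.completeSpace_coe
  choose s hs hu using fun y : K => h y y.2
  have hu' : ∀ (y x : K), (∀ i, inner ℂ (g i) (x : E) = inner ℂ (e i) (y : E)) → (x : E) = s y :=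
    fun y x hx => hu y x ⟨x.2, hx⟩
  let S : K →ₗ[ℂ] K :=
    { toFun := fun y => ⟨s y, (hs y).1⟩
      map_add' := fun y z => Subtype.ext <| (hu' (y + z) (⟨s y, (hs y).1⟩ + ⟨s z, (hs z).1⟩)
        fun i => by
          simp only [Submodule.coe_add, inner_add_right, (hs y).2 i, (hs z).2 i]).symm
      map_smul' := fun r y => Subtype.ext <| (hu' (r • y) (r • ⟨s y, (hs y).1⟩) fun i => by
          simp only [Submodule.coe_smul, inner_smul_right, (hs y).2 i]).symm }
  have hS : Continuous S := by
    refine S.continuous_of_seq_closed_graph fun u y x hu1 hu2 => ?_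
    refine Subtype.ext (hu' y x fun i => ?_)
    have h1 : Tendsto (fun n => inner ℂ (g i) (S (u n) : E)) atTop (𝓝 (inner ℂ (g i) (x : E))) :=
      ((continuous_const.inner continuous_subtype_val).tendsto x).comp hu2
    have h2 : Tendsto (fun n => inner ℂ (e i) (u n : E)) atTop (𝓝 (inner ℂ (e i) (y : E))) :=
      ((continuous_const.inner continuous_subtype_val).tendsto y).comp hu1
    refine tendsto_nhds_unique h1 (h2.congr fun n => ((hs (u n)).2 i).symm)
  refine ⟨‖(⟨S, hS⟩ : K →L[ℂ] K)‖, fun x hx y hy hxy => ?_⟩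
  have h1 := (⟨S, hS⟩ : K →L[ℂ] K).le_opNorm ⟨y, hy⟩
  have h2 : x = s ⟨y, hy⟩ := hu' ⟨y, hy⟩ ⟨x, hx⟩ hxy
  rw [h2]
  exact h1

/-- If the block Toeplitz matrix with a square-integrable symbol `G` is invertible over an index
set that contains all large indices, then `G` is bounded below. A vector polynomial multiplied by
`e^{i N t}` has frequencies in `Γ`, and its image under the matrix is a projection of its product
with `G`. -/
lemma exists_lower_bound_symbol {G : ℝ → Matrix (Fin T) (Fin T) ℂ}
    (hG : ∀ i j, MemLp (fun t => G t i j) 2 normFreq) {Γ : Set ℤ} (hΓ : ∀ n, 0 ≤ n → n ∈ Γ)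
    (hbij : ∀ y : Γ → Fin T → ℂ, Memℓp y 2 →
      ∃! x : Γ → Fin T → ℂ, Memℓp x 2 ∧ BlockApply (toeplitzBlock G) Γ x y) :
    ∃ M : ℝ, ∀ᵐ t ∂normFreq, ∀ v : Fin T → ℂ,
      (v ⬝ᵥ star v).re ≤ M ^ 2 * ((v ᵥ* G t) ⬝ᵥ star (v ᵥ* G t)).re := by
  have hKc : IsClosed (freqSubspace T Γ : Set (L2Vec T)) := Submodule.isClosed_orthogonal _
  have : CompleteSpace (freqSubspace T Γ) := hKc.completeSpace_coe
  obtain ⟨M, hM⟩ := exists_bound_of_existsUnique (freqSubspace T Γ) hKc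
    (fun k : Γ × Fin T => expL2 ((k.1 : ℤ), k.2))
    (fun k : Γ × Fin T => toeplitzRow G hG ((k.1 : ℤ), k.2)) (by
      intro y hy
      obtain ⟨x, ⟨hx1, hx2⟩, hxu⟩ := hbij (coeffs Γ y) (memℓp_coeffs Γ y)
      obtain ⟨x, hxΓ, rfl⟩ := exists_coeffs_eq hx1
      refine ⟨x, ⟨hxΓ, fun k => ?_⟩, ?_⟩
      · exact congrFun (congrFun (blockApply_unique (blockApply_coeffs hG hxΓ) hx2) k.1) k.2
      · rintro x' ⟨hx', hx'y⟩
        refine coeffs_injOn hx' hxΓ (hxu _ ⟨memℓp_coeffs Γ x', ?_⟩)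
        convert blockApply_coeffs hG hx' using 1
        funext m ν
        exact (hx'y (m, ν)).symm)
  refine ⟨M, ?_⟩
  have hvG : ∀ v : Fin T → ℂ, MemLp (fun t => v ᵥ* G t) 2 normFreq := fun v =>
    memLp_vecMul (p := ∞) (memLp_const v) hG
  have key : ∀ v : Fin T → ℂ, ∀ᵐ t ∂normFreq,
      0 ≤ M ^ 2 * ((v ᵥ* G t) ⬝ᵥ star (v ᵥ* G t)).re - (v ⬝ᵥ star v).re := by
    intro v
    have hI1 : Integrable (fun t => ((v ᵥ* G t) ⬝ᵥ star (v ᵥ* G t)).re) normFreq :=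
      (integrable_dotProduct_star (hvG v) (hvG v)).re
    refine ae_nonneg_of_integral_normSq_trigPoly
      ((hI1.const_mul (M ^ 2)).sub (integrable_const _)) fun q hq => ?_
    set φ : ℝ → ℂ := fun t => q.sum fun n z => z * expI n t with hφ
    have hφc : Continuous φ := by simp only [hφ, Finsupp.sum]; fun_prop
    have hφb : MemLp φ ∞ normFreq := by
      refine memLp_top_of_bound hφc.aestronglyMeasurable (∑ n ∈ q.support, ‖q n‖)
        (.of_forall fun t => ?_)
      refine (norm_sum_le _ _).trans_eq (Finset.sum_congr rfl fun n _ => ?_)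
      rw [norm_mul, norm_expI, mul_one]
    have hφv : MemLp (fun t => φ t • v) ∞ normFreq :=
      memLp_pi_iff.2 fun i => by simpa [mul_comm] using hφb.const_mul (v i)
    have hφv2 : MemLp (fun t => φ t • v) 2 normFreq := hφv.mono_exponent le_top
    have hφG : MemLp (fun t => (φ t • v) ᵥ* G t) 2 normFreq := memLp_vecMul (p := ∞) hφv hG
    have hmem : toVec _ hφv2 ∈ freqSubspace T Γ := by
      rw [mem_freqSubspace]
      intro k hk
      rw [inner_expL2_toVec]
      have e : ∀ t, (φ t • v) k.2 * expI (-k.1) t =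
          ∑ n ∈ q.support, (q n * v k.2) * expI (n + -k.1) t := fun t => by
        simp only [hφ, Finsupp.sum, Pi.smul_apply, smul_eq_mul, expI_add, Finset.sum_mul]
        exact Finset.sum_congr rfl fun n _ => by ring
      simp only [e]
      rw [integral_finsetSum]
      · refine Finset.sum_eq_zero fun n hn => ?_
        rw [integral_const_mul, integral_expI, if_neg, mul_zero]
        intro h0
        exact hk (hΓ _ (by have := hq n hn; lia))
      · intro n _
        exact ((memLp_top_of_bound (continuous_expI _).aestronglyMeasurable 1
          (.of_forall fun t => (norm_expI _ t).le)).integrable le_top).const_mul _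
    have hb := hM _ hmem ((freqSubspace T Γ).starProjection (toVec _ hφG))
      (Submodule.starProjection_apply_mem _ _) (fun k => by
        rw [inner_toeplitzRow hG, ← inner_expL2_toVec _ hφG,
          ← Submodule.inner_starProjection_left_eq_right,
          Submodule.starProjection_eq_self_iff.2 (expL2_mem_freqSubspace k.1.2)])
    have hb2 : ‖toVec _ hφv2‖ ^ 2 ≤ M ^ 2 * ‖toVec _ hφG‖ ^ 2 := by
      have h1 : ‖toVec _ hφv2‖ ≤ |M| * ‖toVec _ hφG‖ := by
        refine hb.trans ?_
        gcongr
        · exact le_abs_self M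
        · exact Submodule.norm_starProjection_apply_le _ _
      calc _ ≤ (|M| * ‖toVec _ hφG‖) ^ 2 := by gcongr
        _ = _ := by rw [mul_pow, sq_abs]
    rw [norm_sq_toVec, norm_sq_toVec, ← integral_const_mul, ← sub_nonneg, ← integral_sub] at hb2
    · refine hb2.trans_eq (integral_congr_ae (.of_forall fun t => ?_))
      simp only [Matrix.smul_vecMul, star_smul, dotProduct_smul, smul_dotProduct, smul_eq_mul]
      have : ∀ z : ℂ, star (φ t) * (φ t * z) = ((‖φ t‖ ^ 2 : ℝ) : ℂ) * z := fun z => by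
        rw [← mul_assoc, mul_comm (star (φ t)), Complex.star_def, Complex.mul_conj,
          Complex.normSq_eq_norm_sq]
      simp only [this, Complex.re_ofReal_mul]
      ring
    · exact (integrable_dotProduct_star hφG hφG).re.const_mul _
    · exact (integrable_dotProduct_star hφv2 hφv2).re
  have hall := ae_all_iff.2 fun n => key (TopologicalSpace.denseSeq (Fin T → ℂ) n)
  filter_upwards [hall] with t ht v
  have hcl : IsClosed {v : Fin T → ℂ |
      0 ≤ M ^ 2 * ((v ᵥ* G t) ⬝ᵥ star (v ᵥ* G t)).re - (v ⬝ᵥ star v).re} := by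
    refine isClosed_le continuous_const ?_
    simp only [dotProduct, Matrix.vecMul, Pi.star_apply]
    fun_prop
  have hu := (TopologicalSpace.denseRange_denseSeq (Fin T → ℂ)).closure_range
  have : v ∈ closure (range (TopologicalSpace.denseSeq (Fin T → ℂ))) := by rw [hu]; trivial
  exact sub_nonneg.1 (hcl.closure_subset_iff.2 (by rintro _ ⟨n, rfl⟩; exact ht n) this)

/-- A Hermitian symbol whose block Toeplitz matrix has square-summable columns is itself
square-integrable. -/
lemma memLp_symbol_of_column_mem {G : ℝ → Matrix (Fin T) (Fin T) ℂ}
    (hG : ∀ i j, Integrable (fun t => G t i j) normFreq)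
    (hherm : ∀ᵐ t ∂normFreq, (G t).IsHermitian) {Γ : Set ℤ} (hΓ : ∀ n, 0 ≤ n → n ∈ Γ)
    (hcol : ∀ (n : Γ) (ν : Fin T),
      Memℓp (fun m : Γ => fun μ : Fin T => toeplitzBlock G (m - n) μ ν) 2) (i j : Fin T) :
    MemLp (fun t => G t i j) 2 normFreq := by
  have hconj : ∀ (n : ℤ) (μ ν : Fin T),
      ‖toeplitzBlock G (-n) μ ν‖ = ‖toeplitzBlock G n ν μ‖ := by
    intro n μ ν
    rw [← Complex.norm_conj (toeplitzBlock G n ν μ), toeplitzBlock_apply, toeplitzBlock_apply,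
      ← integral_conj]
    congr 1
    refine integral_congr_ae ?_
    filter_upwards [hherm] with t ht
    rw [map_mul, conj_expI, ← ht.apply ν μ]
    rfl
  have hnat : ∀ μ ν : Fin T, Summable fun n : ℕ => ‖toeplitzBlock G n μ ν‖ ^ 2 := by
    intro μ ν
    have h := (memℓp_two_iff.1 (hcol ⟨0, hΓ 0 le_rfl⟩ ν)).comp_injective
      (i := fun n : ℕ => ((⟨(n : ℤ), hΓ n n.cast_nonneg⟩ : Γ), μ)) (fun m n h => by
        simpa using h)
    simpa [Function.comp_def] using h
  have h := memLp_two_of_summable_fourier (b := fun t => G t i) (fun ν => hG i ν) (by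
    rw [summable_prod_of_nonneg fun _ => by positivity]
    refine ⟨fun n => (hasSum_fintype _).summable, ?_⟩
    simp only [tsum_fintype]
    refine summable_sum fun μ _ => ?_
    simp only [← toeplitzBlock_apply]
    refine Summable.of_nat_of_neg (hnat μ i) ?_
    simp only [hconj]
    exact hnat i μ)
  exact memLp_pi_iff.1 h j

end Toeplitz

/-! ### Positive semidefinite matrix functions -/

section MatrixFunctions

variable {T : ℕ}

lemma normSq_apply_le_of_isHermitian {Q : Matrix (Fin T) (Fin T) ℂ} (hQ : Q.IsHermitian)
    (i j : Fin T) : ‖Q i j‖ ^ 2 ≤ ((Q * Q) i i).re := by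
  have : ((Q * Q) i i).re = ∑ k, ‖Q i k‖ ^ 2 := by
    rw [Matrix.mul_apply, Complex.re_sum]
    refine Finset.sum_congr rfl fun k _ => ?_
    rw [← hQ.apply k i, Complex.star_def, Complex.mul_conj, Complex.ofReal_re,
      Complex.normSq_eq_norm_sq]
  rw [this]
  exact Finset.single_le_sum (f := fun k => ‖Q i k‖ ^ 2) (fun _ _ => by positivity)
    (Finset.mem_univ j)

lemma Matrix.PosSemidef.norm_apply_le_trace {A : Matrix (Fin T) (Fin T) ℂ} (hA : A.PosSemidef)
    (i j : Fin T) : ‖A i j‖ ≤ A.trace.re := by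
  open scoped MatrixOrder in
  obtain ⟨B, hB⟩ := CStarAlgebra.nonneg_iff_eq_star_mul_self.mp hA.nonneg
  have h1 : ∀ l, (A l l).re = ∑ k, ‖B k l‖ ^ 2 := by
    intro l
    rw [hB, Matrix.star_eq_conjTranspose, Matrix.mul_apply, Complex.re_sum]
    refine Finset.sum_congr rfl fun k _ => ?_
    rw [Matrix.conjTranspose_apply, Complex.star_def, mul_comm, Complex.mul_conj,
      Complex.ofReal_re, Complex.normSq_eq_norm_sq]
  have h2 : ∀ l, (A l l).re ≤ A.trace.re := by
    intro l
    rw [Matrix.trace, Complex.re_sum]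
    refine Finset.single_le_sum (f := fun l => (A l l).re) (fun l _ => ?_) (Finset.mem_univ l)
    rw [h1]; positivity
  have h3 : ‖A i j‖ ≤ ((A i i).re + (A j j).re) / 2 := by
    rw [h1, h1, ← Finset.sum_add_distrib, Finset.sum_div, hB, Matrix.star_eq_conjTranspose,
      Matrix.mul_apply]
    refine (norm_sum_le _ _).trans (Finset.sum_le_sum fun k _ => ?_)
    rw [Matrix.conjTranspose_apply, norm_mul, norm_star]
    nlinarith [sq_nonneg (‖B k i‖ - ‖B k j‖)]
  linarith [h2 i, h2 j]

lemma quadForm_eq_of_isHermitian {Q : Matrix (Fin T) (Fin T) ℂ} (hQ : Q.IsHermitian)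
    (b : Fin T → ℂ) : quadForm (Q * Q) b = (b ᵥ* Q) ⬝ᵥ star (b ᵥ* Q) := by
  rw [quadForm, ← Matrix.vecMul_vecMul, vecMul_dotProduct_star, hQ.eq]

lemma quadForm_nonneg {A : Matrix (Fin T) (Fin T) ℂ} (hA : A.PosSemidef) (b : Fin T → ℂ) :
    0 ≤ quadForm A b := by
  have := hA.dotProduct_mulVec_nonneg (star b)
  rwa [star_star, Matrix.dotProduct_mulVec] at this

lemma aestronglyMeasurable_of_apply {ι E : Type*} [Finite ι] [NormedAddCommGroup E]
    {b : ℝ → ι → E} {μ : Measure ℝ} (hb : ∀ i, AEStronglyMeasurable (fun t => b t i) μ) :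
    AEStronglyMeasurable b μ := by
  classical
  have := Fintype.ofFinite ι
  have e : b = ∑ i, fun t => (Pi.single i (b t i) : ι → E) := by ext; simp
  rw [e]
  exact Finset.aestronglyMeasurable_sum _ fun i _ =>
    (continuous_single i).comp_aestronglyMeasurable (hb i)

lemma exists_bound_of_memLp_top {E : Type*} [NormedAddCommGroup E] {b : ℝ → E} {μ : Measure ℝ}
    (hb : MemLp b ∞ μ) : ∃ C : NNReal, ∀ᵐ t ∂μ, ‖b t‖ ≤ C := by
  have h := hb.2
  rw [eLpNorm_exponent_top] at h
  refine ⟨(eLpNormEssSup b μ).toNNReal, ?_⟩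
  filter_upwards [ae_le_eLpNormEssSup (f := b) (μ := μ)] with t ht
  rw [← ENNReal.coe_toNNReal h.ne, enorm_eq_nnnorm, ENNReal.coe_le_coe] at ht
  exact_mod_cast ht

lemma aestronglyMeasurable_vecMul {b : ℝ → Fin T → ℂ} {M : ℝ → Matrix (Fin T) (Fin T) ℂ}
    {μ : Measure ℝ} (hb : AEStronglyMeasurable b μ)
    (hM : ∀ i j, AEStronglyMeasurable (fun t => M t i j) μ) :
    AEStronglyMeasurable (fun t => b t ᵥ* M t) μ := by
  have hb' := fun i => (continuous_apply i).comp_aestronglyMeasurable hb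
  refine aestronglyMeasurable_of_apply fun j => ?_
  simp only [Matrix.vecMul, dotProduct]
  exact Finset.aestronglyMeasurable_fun_sum _ fun i _ => (hb' i).mul (hM i j)

lemma aestronglyMeasurable_quadForm {b : ℝ → Fin T → ℂ} {M : ℝ → Matrix (Fin T) (Fin T) ℂ}
    {μ : Measure ℝ} (hb : AEStronglyMeasurable b μ)
    (hM : ∀ i j, AEStronglyMeasurable (fun t => M t i j) μ) :
    AEStronglyMeasurable (fun t => quadForm (M t) (b t)) μ := by
  have hb' := fun i => (continuous_apply i).comp_aestronglyMeasurable hb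
  have hbM := fun i => (continuous_apply i).comp_aestronglyMeasurable
    (aestronglyMeasurable_vecMul hb hM)
  simp only [quadForm, dotProduct, Pi.star_apply]
  exact Finset.aestronglyMeasurable_fun_sum _ fun i _ => (hbM i).mul (hb' i).star

lemma aestronglyMeasurable_matrix {M : ℝ → Matrix (Fin T) (Fin T) ℂ} {μ : Measure ℝ}
    (hM : ∀ i j, AEStronglyMeasurable (fun t => M t i j) μ) : AEStronglyMeasurable M μ := by
  have : AEStronglyMeasurable (fun t => (fun i j => M t i j : Fin T → Fin T → ℂ)) μ :=
    aestronglyMeasurable_of_apply fun i => aestronglyMeasurable_of_apply fun j => hM i j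
  exact this

lemma aestronglyMeasurable_matrix_inv {M : ℝ → Matrix (Fin T) (Fin T) ℂ} {μ : Measure ℝ}
    (hM : ∀ i j, AEStronglyMeasurable (fun t => M t i j) μ) (i j : Fin T) :
    AEStronglyMeasurable (fun t => (M t)⁻¹ i j) μ := by
  have hm := aestronglyMeasurable_matrix hM
  have h1 : AEStronglyMeasurable (fun t => (M t).det) μ :=
    (continuous_id.matrix_det).comp_aestronglyMeasurable hm
  have h2 : AEStronglyMeasurable (fun t => (M t).adjugate i j) μ :=
    ((continuous_id.matrix_adjugate).matrix_elem i j).comp_aestronglyMeasurable hm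
  simp only [Matrix.inv_def, Matrix.smul_apply, Ring.inverse_eq_inv', smul_eq_mul]
  exact (h1.aemeasurable.inv.aestronglyMeasurable).mul h2

open scoped MatrixOrder Matrix.Norms.L2Operator in
/-- A bounded measurable positive semidefinite matrix function has a measurable square root: the
square root of the functional calculus is continuous on bounded sets of positive semidefinite
matrices. -/
lemma exists_measurable_sqrt {F : ℝ → Matrix (Fin T) (Fin T) ℂ} {μ : Measure ℝ}
    (hF : ∀ i j, MemLp (fun t => F t i j) ∞ μ) (hpos : ∀ᵐ t ∂μ, (F t).PosSemidef) :
    ∃ Q : ℝ → Matrix (Fin T) (Fin T) ℂ, (∀ i j, AEStronglyMeasurable (fun t => Q t i j) μ) ∧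
      ∀ᵐ t ∂μ, (Q t).IsHermitian ∧ Q t * Q t = F t := by
  refine ⟨fun t => CFC.sqrt (F t), ?_, ?_⟩
  swap
  · filter_upwards [hpos] with t ht
    refine ⟨?_, CFC.sqrt_mul_sqrt_self _ ht.nonneg⟩
    exact (Matrix.nonneg_iff_posSemidef.1 (CFC.sqrt_nonneg (F t))).isHermitian
  have hm : AEStronglyMeasurable F μ := aestronglyMeasurable_matrix fun i j => (hF i j).1
  obtain ⟨R, hR⟩ : ∃ R : NNReal, ∀ᵐ t ∂μ, ‖F t‖ ≤ R := by
    choose C hC using fun i j => exists_bound_of_memLp_top (hF i j)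
    refine ⟨∑ i, ∑ j, C i j * ‖(Matrix.single i j 1 : Matrix (Fin T) (Fin T) ℂ)‖₊, ?_⟩
    filter_upwards [ae_all_iff.2 fun i => ae_all_iff.2 fun j => hC i j] with t ht
    rw [Matrix.matrix_eq_sum_single (F t)]
    push_cast
    refine (norm_sum_le _ _).trans (Finset.sum_le_sum fun i _ => ?_)
    refine (norm_sum_le _ _).trans (Finset.sum_le_sum fun j _ => ?_)
    have : Matrix.single i j (F t i j) = F t i j • Matrix.single i j (1 : ℂ) := by
      rw [Matrix.smul_single, smul_eq_mul, mul_one]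
    rw [this, norm_smul]
    gcongr
    exact ht i j
  let _ : MeasurableSpace (Matrix (Fin T) (Fin T) ℂ) := borel _
  have : BorelSpace (Matrix (Fin T) (Fin T) ℂ) := ⟨rfl⟩
  set s : Set (Matrix (Fin T) (Fin T) ℂ) := {A | 0 ≤ A ∧ ‖A‖ ≤ R} with hs
  have hsc : IsClosed s := by
    refine IsClosed.inter ?_ (isClosed_le continuous_norm continuous_const)
    exact isClosed_Ici
  have hcont : ContinuousOn (CFC.sqrt : Matrix (Fin T) (Fin T) ℂ → _) s := by
    have := (continuousOn_cfc_nnreal (Matrix (Fin T) (Fin T) ℂ) (s := Icc 0 R) isCompact_Icc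
      NNReal.sqrt (by fun_prop))
    refine (this.mono ?_).congr fun A _ => CFC.sqrt_eq_cfc
    rintro A ⟨hA, hAR⟩
    refine ⟨hA, fun x hx => ⟨zero_le, ?_⟩⟩
    exact (CStarAlgebra.le_nnnorm_of_mem_quasispectrum
      (spectrum_subset_quasispectrum NNReal A hx)).trans hAR
  have hmap : AEStronglyMeasurable (CFC.sqrt : Matrix (Fin T) (Fin T) ℂ → _) (μ.map F) := by
    have h := hcont.aestronglyMeasurable (μ := μ.map F) hsc.measurableSet
    rwa [Measure.restrict_eq_self_of_ae_mem] at h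
    refine (ae_map_iff hm.aemeasurable hsc.measurableSet).2 ?_
    filter_upwards [hpos, hR] with t h1 h2
    exact ⟨h1.nonneg, h2⟩
  have h := hmap.comp_aemeasurable hm.aemeasurable
  intro i j
  exact (continuous_id.matrix_elem i j).comp_aestronglyMeasurable h

end MatrixFunctions

/-! ### Regularity of the spectral densities -/

section Densities

variable {T : ℕ}

/-- A pair of bounded spectral densities `f`, `g` for which `(f + g)⁻¹` is square-integrable. -/
structure IsRegularPair (f g : ℝ → Matrix (Fin T) (Fin T) ℂ) : Prop where
  posf : ∀ᵐ t ∂normFreq, (f t).PosSemidef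
  posg : ∀ᵐ t ∂normFreq, (g t).PosSemidef
  isUnit : ∀ᵐ t ∂normFreq, IsUnit (f t + g t)
  bddf : ∀ i j, MemLp (fun t => f t i j) ∞ normFreq
  bddg : ∀ i j, MemLp (fun t => g t i j) ∞ normFreq
  inv : ∀ i j, MemLp (fun t => (f t + g t)⁻¹ i j) 2 normFreq

/-- Invertibility of the block matrix `𝐁` in `ℓ²` is a strong assumption: it makes `(f + g)⁻¹`
square-integrable (the columns) and bounded below (the bounded inverse), hence `f` and `g`
bounded. -/
lemma isRegularPair_of_blockInvertible {f g : ℝ → Matrix (Fin T) (Fin T) ℂ}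
    (hf : ∀ ν μ, Integrable (fun t => f t ν μ) freqMeasure)
    (hg : ∀ ν μ, Integrable (fun t => g t ν μ) freqMeasure)
    (hfp : ∀ᵐ t ∂freqMeasure, (f t).PosSemidef) (hgp : ∀ᵐ t ∂freqMeasure, (g t).PosSemidef)
    (hmin : MinimalityCondition f g) {Γ : Set ℤ} (hΓ : ∀ n, 0 ≤ n → n ∈ Γ)
    (hB : BlockInvertible (blockB f g) Γ) : IsRegularPair f g := by
  have hfp' := ae_normFreq_iff.2 hfp
  have hgp' := ae_normFreq_iff.2 hgp
  have hu := ae_normFreq_iff.2 hmin.1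
  have hfm : ∀ i j, AEStronglyMeasurable (fun t => f t i j) normFreq := fun i j =>
    aestronglyMeasurable_normFreq_iff.2 (hf i j).1
  have hgm : ∀ i j, AEStronglyMeasurable (fun t => g t i j) normFreq := fun i j =>
    aestronglyMeasurable_normFreq_iff.2 (hg i j).1
  have hherm : ∀ᵐ t ∂normFreq, ((f t + g t)⁻¹).PosSemidef := by
    filter_upwards [hfp', hgp'] with t h1 h2
    exact (h1.add h2).inv
  have hint : ∀ i j, Integrable (fun t => (f t + g t)⁻¹ i j) normFreq := by
    intro i j
    refine (integrable_normFreq_iff.2 hmin.2).re.mono'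
      (aestronglyMeasurable_matrix_inv (fun i j => (hfm i j).add (hgm i j)) i j) ?_
    filter_upwards [hherm] with t ht
    exact ht.norm_apply_le_trace i j
  have hinv := memLp_symbol_of_column_mem hint (hherm.mono fun t h => h.isHermitian) hΓ
    hB.column_mem
  obtain ⟨M, hM⟩ := exists_lower_bound_symbol hinv hΓ hB.bijective
  -- apply the lower bound to the rows of `f + g`
  have hbdd : ∀ᵐ t ∂normFreq, ∀ i, ‖(f t + g t) i i‖ ≤ |M| := by
    filter_upwards [hM, hu] with t ht hut i
    have h1 := ht ((f t + g t) i)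
    have h2 : (f t + g t) i ᵥ* (f t + g t)⁻¹ = Pi.single i 1 := by
      rw [← Matrix.mul_apply_eq_vecMul, Matrix.mul_nonsing_inv _
        ((Matrix.isUnit_iff_isUnit_det _).1 hut)]
      funext j
      rw [Matrix.one_apply, Pi.single_apply]
      simp only [eq_comm]
    rw [h2, ← Pi.single_star, dotProduct_single, Pi.single_eq_same, star_one, one_mul,
      Complex.one_re, mul_one, dotProduct, Complex.re_sum] at h1
    have h3 : ‖(f t + g t) i i‖ ^ 2 ≤ M ^ 2 := by
      refine le_trans ?_ h1
      refine le_trans (le_of_eq ?_) (Finset.single_le_sum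
        (f := fun j => ((f t + g t) i j * star ((f t + g t) i) j).re) (fun j _ => ?_)
        (Finset.mem_univ i))
      · simp only [Pi.star_apply, Complex.star_def]
        rw [Complex.mul_conj, Complex.ofReal_re, Complex.normSq_eq_norm_sq]
      · simp only [Pi.star_apply, Complex.star_def]
        rw [Complex.mul_conj, Complex.ofReal_re]
        exact Complex.normSq_nonneg _
    exact (le_abs_self _).trans (sq_le_sq.1 h3)
  have htr : ∀ᵐ t ∂normFreq, (f t).trace.re ≤ T * |M| ∧ (g t).trace.re ≤ T * |M| := by
    filter_upwards [hbdd, hfp', hgp'] with t ht h1 h2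
    have h3 : (f t).trace.re + (g t).trace.re ≤ T * |M| := by
      rw [← Complex.add_re, ← Matrix.trace_add, Matrix.trace, Complex.re_sum]
      calc _ ≤ ∑ _i : Fin T, |M| := by
            gcongr with i
            exact (Complex.re_le_norm _).trans (ht i)
        _ = T * |M| := by simp
    have h4 := (Complex.nonneg_iff.1 h1.trace_nonneg).1
    have h5 := (Complex.nonneg_iff.1 h2.trace_nonneg).1
    constructor <;> linarith
  refine ⟨hfp', hgp', hu, fun i j => ?_, fun i j => ?_, hinv⟩
  · refine memLp_top_of_bound (hfm i j) (T * |M|) ?_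
    filter_upwards [htr, hfp'] with t ht h1
    exact (h1.norm_apply_le_trace i j).trans ht.1
  · refine memLp_top_of_bound (hgm i j) (T * |M|) ?_
    filter_upwards [htr, hgp'] with t ht h1
    exact (h1.norm_apply_le_trace i j).trans ht.2

/-- `Q` is a bounded Hermitian square root of the density `F`, with square-integrable inverse. The
map `b ↦ bᵀ Q` identifies `L₂(F)` with `L2Vec T`. -/
structure IsDensitySqrt (F Q : ℝ → Matrix (Fin T) (Fin T) ℂ) : Prop where
  bdd : ∀ i j, MemLp (fun t => Q t i j) ∞ normFreq
  inv : ∀ i j, MemLp (fun t => (Q t)⁻¹ i j) 2 normFreq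
  ae : ∀ᵐ t ∂normFreq, (Q t).IsHermitian ∧ Q t * Q t = F t ∧ IsUnit (Q t).det

lemma IsRegularPair.exists_sqrt {f g : ℝ → Matrix (Fin T) (Fin T) ℂ} (h : IsRegularPair f g) :
    ∃ Q, IsDensitySqrt (fun t => f t + g t) Q := by
  have hF : ∀ i j, MemLp (fun t => (f t + g t) i j) ∞ normFreq := fun i j =>
    (h.bddf i j).add (h.bddg i j)
  obtain ⟨Q, hQm, hQ⟩ := exists_measurable_sqrt hF (by
    filter_upwards [h.posf, h.posg] with t h1 h2 using h1.add h2)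
  refine ⟨Q, ?_, ?_, ?_⟩
  · intro i j
    obtain ⟨C, hC⟩ := exists_bound_of_memLp_top (hF i i)
    refine memLp_top_of_bound (hQm i j) (√C) ?_
    filter_upwards [hQ, hC] with t ht hCt
    refine Real.le_sqrt_of_sq_le ((normSq_apply_le_of_isHermitian ht.1 i j).trans ?_)
    rw [ht.2]
    exact (Complex.re_le_norm _).trans hCt
  · intro i j
    rw [memLp_two_iff_integrable_sq_norm (aestronglyMeasurable_matrix_inv hQm i j)]
    refine ((h.inv i i).integrable (by norm_num)).norm.mono'
      ((aestronglyMeasurable_matrix_inv hQm i j).norm.pow 2) ?_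
    filter_upwards [hQ] with t ht
    rw [norm_pow, norm_norm, ← ht.2, Matrix.mul_inv_rev]
    exact (normSq_apply_le_of_isHermitian ht.1.inv i j).trans (Complex.re_le_norm _)
  · filter_upwards [hQ, h.isUnit] with t ht hu
    refine ⟨ht.1, ht.2, ?_⟩
    rw [← ht.2, Matrix.isUnit_iff_isUnit_det, Matrix.det_mul] at hu
    exact isUnit_of_mul_isUnit_left hu

variable {F Q : ℝ → Matrix (Fin T) (Fin T) ℂ}

lemma IsDensitySqrt.quadForm_eq (hQ : IsDensitySqrt F Q) :
    ∀ᵐ t ∂normFreq, ∀ b, quadForm (F t) b = (b ᵥ* Q t) ⬝ᵥ star (b ᵥ* Q t) := by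
  filter_upwards [hQ.ae] with t ht b
  rw [← ht.2.1, quadForm_eq_of_isHermitian ht.1]

lemma dotProduct_star_self_re (v : Fin T → ℂ) :
    v ⬝ᵥ star v = ((∑ i, ‖v i‖ ^ 2 : ℝ) : ℂ) := by
  rw [dotProduct]
  push_cast
  refine Finset.sum_congr rfl fun i _ => ?_
  rw [Pi.star_apply, Complex.star_def, Complex.mul_conj, Complex.normSq_eq_norm_sq]
  push_cast; rfl

lemma memLp_two_iff_integrable_dotProduct {b : ℝ → Fin T → ℂ}
    (hb : AEStronglyMeasurable b normFreq) :
    MemLp b 2 normFreq ↔ Integrable (fun t => b t ⬝ᵥ star (b t)) normFreq := by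
  refine ⟨fun h => integrable_dotProduct_star h h, fun h => memLp_pi_iff.2 fun i => ?_⟩
  have hbi := (continuous_apply i).comp_aestronglyMeasurable hb
  rw [memLp_two_iff_integrable_sq_norm hbi]
  refine h.norm.mono' (hbi.norm.pow 2) (.of_forall fun t => ?_)
  rw [dotProduct_star_self_re, Complex.norm_real, norm_pow, norm_norm,
    Real.norm_of_nonneg (by positivity)]
  exact Finset.single_le_sum (f := fun i => ‖b t i‖ ^ 2) (fun _ _ => by positivity)
    (Finset.mem_univ i)

lemma IsDensitySqrt.memL2Density_iff (hQ : IsDensitySqrt F Q) {b : ℝ → Fin T → ℂ} :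
    MemL2Density F b ↔ MemLp (fun t => b t ᵥ* Q t) 2 normFreq := by
  have hcongr : (fun t => quadForm (F t) (b t)) =ᵐ[normFreq]
      fun t => (b t ᵥ* Q t) ⬝ᵥ star (b t ᵥ* Q t) := by
    filter_upwards [hQ.quadForm_eq] with t ht using ht _
  rw [MemL2Density, ← integrable_normFreq_iff, ← aestronglyMeasurable_normFreq_iff,
    integrable_congr hcongr]
  constructor
  · rintro ⟨h1, h2⟩
    exact (memLp_two_iff_integrable_dotProduct
      (aestronglyMeasurable_vecMul h1 fun i j => (hQ.bdd i j).1)).2 h2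
  · intro h
    refine ⟨?_, integrable_dotProduct_star h h⟩
    refine (aestronglyMeasurable_vecMul h.1 fun i j => (hQ.inv i j).1).congr ?_
    filter_upwards [hQ.ae] with t ht
    rw [Matrix.vecMul_vecMul, Matrix.mul_nonsing_inv _ ht.2.2, Matrix.vecMul_one]

lemma IsDensitySqrt.sqNormDensity_eq (hQ : IsDensitySqrt F Q) {b : ℝ → Fin T → ℂ}
    (hb : MemLp (fun t => b t ᵥ* Q t) 2 normFreq) :
    sqNormDensity F b = 2 * π * ‖toVec _ hb‖ ^ 2 := by
  have : ‖toVec _ hb‖ ^ 2 = ∫ t, (quadForm (F t) (b t)).re ∂normFreq := by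
    rw [norm_sq_toVec]
    refine integral_congr_ae ?_
    filter_upwards [hQ.quadForm_eq] with t ht
    rw [ht]
  rw [this, integral_normFreq_real, sqNormDensity]
  have := Real.pi_pos
  field_simp

/-- The functions `e^{i n t} δ_ν Q`. -/
noncomputable def IsDensitySqrt.expL2 (hQ : IsDensitySqrt F Q) (k : ℤ × Fin T) : L2Vec T :=
  toVec (fun t => expVec k t ᵥ* Q t) (memLp_vecMul (q := ∞) (memLp_expVec k) hQ.bdd)

lemma IsDensitySqrt.inner_expL2 (hQ : IsDensitySqrt F Q) (k : ℤ × Fin T) {b : ℝ → Fin T → ℂ}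
    (hb : MemLp b 2 normFreq) :
    inner ℂ (hQ.expL2 k) (toVec b hb) = ∫ t, (b t ᵥ* Q t) k.2 * expI (-k.1) t ∂normFreq := by
  rw [IsDensitySqrt.expL2, inner_toVec]
  refine integral_congr_ae ?_
  filter_upwards [hQ.ae] with t ht
  rw [← dotProduct_star_expVec, vecMul_dotProduct_star, ht.1.eq]

lemma IsDensitySqrt.inner_expL2_expL2 (hQ : IsDensitySqrt F Q) (k l : ℤ × Fin T) :
    inner ℂ (hQ.expL2 k) (hQ.expL2 l) = ∫ t, expI (l.1 - k.1) t * F t l.2 k.2 ∂normFreq := by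
  rw [IsDensitySqrt.expL2.eq_def hQ l, hQ.inner_expL2]
  refine integral_congr_ae ?_
  filter_upwards [hQ.ae] with t ht
  rw [Matrix.vecMul_vecMul, ht.2.1, expVec, Matrix.single_vecMul, sub_eq_add_neg, expI_add]
  simp only [Pi.smul_apply, Matrix.row_apply, smul_eq_mul]
  ring

lemma IsDensitySqrt.toVec_sub_trigPoly (hQ : IsDensitySqrt F Q) {b : ℝ → Fin T → ℂ}
    (hb : MemLp (fun t => b t ᵥ* Q t) 2 normFreq) (p : (ℤ × Fin T) →₀ ℂ) :
    ∃ h : MemLp (fun t => (b t - trigPoly p t) ᵥ* Q t) 2 normFreq,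
      toVec _ h = toVec _ hb - Finsupp.linearCombination ℂ hQ.expL2 p := by
  obtain ⟨h1, e1⟩ := linearCombination_toVec
    (fun k => memLp_vecMul (q := ∞) (r := 2) (memLp_expVec k) hQ.bdd) p
  have e : (fun t => (b t - trigPoly p t) ᵥ* Q t) =
      fun t => b t ᵥ* Q t - p.sum fun k z => z • (expVec k t ᵥ* Q t) := by
    funext t
    rw [Matrix.sub_vecMul, trigPoly_eq, Finsupp.sum, Finsupp.sum, Matrix.sum_vecMul]
    simp only [Matrix.smul_vecMul]
  have h2 := hb.sub h1
  refine ⟨e ▸ h2, ?_⟩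
  have e3 : Finsupp.linearCombination ℂ hQ.expL2 p = _ := e1
  rw [e3, toVec_sub]
  congr 1

lemma mem_closure_span_image_iff {ι E : Type*} [NormedAddCommGroup E] [NormedSpace ℂ E]
    {v : ι → E} {J : Set ι} {x : E} :
    x ∈ (Submodule.span ℂ (v '' J)).topologicalClosure ↔
      ∀ ε > 0, ∃ p : ι →₀ ℂ, (∀ k ∈ p.support, k ∈ J) ∧
        ‖x - Finsupp.linearCombination ℂ v p‖ < ε := by
  rw [← SetLike.mem_coe, Submodule.topologicalClosure_coe, Metric.mem_closure_iff]
  refine forall₂_congr fun ε _ => ?_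
  constructor
  · rintro ⟨y, hy, hd⟩
    obtain ⟨p, hp, rfl⟩ := (Finsupp.mem_span_image_iff_linearCombination ℂ).1 hy
    exact ⟨p, fun k hk => (Finsupp.mem_supported ℂ p).1 hp hk, by rwa [← dist_eq_norm]⟩
  · rintro ⟨p, hp, hd⟩
    exact ⟨_, (Finsupp.mem_span_image_iff_linearCombination ℂ).2
      ⟨p, (Finsupp.mem_supported ℂ p).2 fun k hk => hp k hk, rfl⟩, by rwa [dist_eq_norm]⟩

lemma two_pi_mul_sq_lt {x δ : ℝ} (hx : 0 ≤ x) (h : x < √(δ / (2 * π))) (hδ : 0 < δ) :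
    2 * π * x ^ 2 < δ := by
  have h1 : x ^ 2 < √(δ / (2 * π)) ^ 2 := by gcongr
  rw [Real.sq_sqrt (by positivity), lt_div_iff₀ (by positivity)] at h1
  linarith

lemma lt_of_two_pi_mul_sq_lt {x ε : ℝ} (hε : 0 < ε) (h : 2 * π * x ^ 2 < 2 * π * ε ^ 2) :
    x < ε :=
  lt_of_pow_lt_pow_left₀ 2 hε.le (lt_of_mul_lt_mul_left h (by positivity))

lemma IsDensitySqrt.memL2Observed_iff (hQ : IsDensitySqrt F Q) {G : Set ℤ}
    {b : ℝ → Fin T → ℂ} :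
    MemL2Observed F G b ↔ ∃ hb : MemLp (fun t => b t ᵥ* Q t) 2 normFreq,
      toVec _ hb ∈ (Submodule.span ℂ
        (hQ.expL2 '' {k | k.1 ≤ -1 ∧ k.1 ∉ G})).topologicalClosure := by
  rw [MemL2Observed, hQ.memL2Density_iff]
  simp only [mem_closure_span_image_iff]
  constructor
  · rintro ⟨hb, h⟩
    refine ⟨hb, fun ε hε => ?_⟩
    obtain ⟨p, hp, hlt⟩ := h (2 * π * ε ^ 2) (by positivity)
    obtain ⟨h1, e1⟩ := hQ.toVec_sub_trigPoly hb p
    rw [hQ.sqNormDensity_eq h1, e1] at hlt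
    exact ⟨p, hp, lt_of_two_pi_mul_sq_lt hε hlt⟩
  · rintro ⟨hb, h⟩
    refine ⟨hb, fun ε hε => ?_⟩
    obtain ⟨p, hp, hlt⟩ := h (√(ε / (2 * π))) (by positivity)
    obtain ⟨h1, e1⟩ := hQ.toVec_sub_trigPoly hb p
    refine ⟨p, hp, ?_⟩
    rw [hQ.sqNormDensity_eq h1, e1]
    exact two_pi_mul_sq_lt (norm_nonneg _) hlt hε

/-- `w` and `η` are simultaneous limits of the same linear combinations of two families. If the
families have equal Gram matrices, this is the graph of the isometry that extends `e k ↦ v k` to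
the closed spans. -/
def IsCommonLimit {ι E E' : Type*} [NormedAddCommGroup E] [NormedSpace ℂ E]
    [NormedAddCommGroup E'] [NormedSpace ℂ E'] (e : ι → E) (v : ι → E') (w : E) (η : E') : Prop :=
  ∀ ε > 0, ∃ p : ι →₀ ℂ, ‖w - Finsupp.linearCombination ℂ e p‖ < ε ∧
    ‖η - Finsupp.linearCombination ℂ v p‖ < ε

lemma IsDensitySqrt.isSpectralIntegral_iff (hQ : IsDensitySqrt F Q) {Ω : Type*}
    [MeasurableSpace Ω] {P : Measure Ω} {X : ℤ → Lp ℂ 2 P} {h : ℝ → Fin T → ℂ} {η : Lp ℂ 2 P} :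
    IsSpectralIntegral X F h η ↔ ∃ hh : MemLp (fun t => h t ᵥ* Q t) 2 normFreq,
      IsCommonLimit hQ.expL2 (fun k => block T X k.1 k.2) (toVec _ hh) η := by
  rw [IsSpectralIntegral, hQ.memL2Density_iff]
  constructor
  · rintro ⟨hb, h⟩
    refine ⟨hb, fun ε hε => ?_⟩
    obtain ⟨p, hlt, hp⟩ := h (min ε (2 * π * ε ^ 2)) (by positivity)
    obtain ⟨h1, e1⟩ := hQ.toVec_sub_trigPoly hb p
    rw [hQ.sqNormDensity_eq h1, e1] at hlt
    exact ⟨p, lt_of_two_pi_mul_sq_lt hε (hlt.trans_le (min_le_right _ _)),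
      hp.trans_le (min_le_left _ _)⟩
  · rintro ⟨hb, h⟩
    refine ⟨hb, fun ε hε => ?_⟩
    obtain ⟨p, hlt, hp⟩ := h (min ε (√(ε / (2 * π)))) (by positivity)
    obtain ⟨h1, e1⟩ := hQ.toVec_sub_trigPoly hb p
    refine ⟨p, ?_, hp.trans_le (min_le_left _ _)⟩
    rw [hQ.sqNormDensity_eq h1, e1]
    exact two_pi_mul_sq_lt (norm_nonneg _) (hlt.trans_le (min_le_right _ _)) hε

end Densities

/-! ### Families with equal Gram matrices -/

section CommonLimit

variable {ι E E' : Type*} [NormedAddCommGroup E] [InnerProductSpace ℂ E]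
  [NormedAddCommGroup E'] [InnerProductSpace ℂ E'] {e : ι → E} {v : ι → E'}

lemma norm_linearCombination_eq_of_gram_eq (h : ∀ k l, inner ℂ (e k) (e l) = inner ℂ (v k) (v l))
    (p : ι →₀ ℂ) :
    ‖Finsupp.linearCombination ℂ e p‖ = ‖Finsupp.linearCombination ℂ v p‖ := by
  have : inner ℂ (Finsupp.linearCombination ℂ e p) (Finsupp.linearCombination ℂ e p) =
      inner ℂ (Finsupp.linearCombination ℂ v p) (Finsupp.linearCombination ℂ v p) := by
    simp only [Finsupp.linearCombination_apply, Finsupp.sum, sum_inner, inner_sum,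
      inner_smul_left, inner_smul_right, h]
  rw [@norm_eq_sqrt_re_inner ℂ, @norm_eq_sqrt_re_inner ℂ, this]

lemma IsCommonLimit.exists_seq {w : E} {η : E'} (h : IsCommonLimit e v w η) :
    ∃ p : ℕ → ι →₀ ℂ, Tendsto (fun n => Finsupp.linearCombination ℂ e (p n)) atTop (𝓝 w) ∧
      Tendsto (fun n => Finsupp.linearCombination ℂ v (p n)) atTop (𝓝 η) := by
  choose p hp using fun n : ℕ => h (1 / (n + 1)) Nat.one_div_pos_of_nat
  refine ⟨p, ?_, ?_⟩ <;> rw [tendsto_iff_norm_sub_tendsto_zero] <;>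
    refine squeeze_zero (fun _ => norm_nonneg _) (fun n => ?_)
      tendsto_one_div_add_atTop_nhds_zero_nat <;> rw [norm_sub_rev]
  exacts [(hp n).1.le, (hp n).2.le]

lemma IsCommonLimit.norm_eq (hG : ∀ k l, inner ℂ (e k) (e l) = inner ℂ (v k) (v l)) {w : E}
    {η : E'} (h : IsCommonLimit e v w η) : ‖w‖ = ‖η‖ := by
  obtain ⟨p, h1, h2⟩ := h.exists_seq
  refine tendsto_nhds_unique h1.norm (h2.norm.congr fun n => ?_)
  exact (norm_linearCombination_eq_of_gram_eq hG _).symm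

lemma IsCommonLimit.inner_eq (hG : ∀ k l, inner ℂ (e k) (e l) = inner ℂ (v k) (v l)) {w : E}
    {η : E'} (h : IsCommonLimit e v w η) (k : ι) : inner ℂ (e k) w = inner ℂ (v k) η := by
  obtain ⟨p, h1, h2⟩ := h.exists_seq
  have h1' := (tendsto_const_nhds (x := e k)).inner (𝕜 := ℂ) h1
  have h2' := (tendsto_const_nhds (x := v k)).inner (𝕜 := ℂ) h2
  refine tendsto_nhds_unique h1' (h2'.congr fun n => ?_)
  simp only [Finsupp.linearCombination_apply, Finsupp.sum, inner_sum, inner_smul_right, hG]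

lemma IsCommonLimit.unique (hG : ∀ k l, inner ℂ (e k) (e l) = inner ℂ (v k) (v l)) {w : E}
    {η η' : E'} (h : IsCommonLimit e v w η) (h' : IsCommonLimit e v w η') : η = η' := by
  obtain ⟨p, h1, h2⟩ := h.exists_seq
  obtain ⟨q, h3, h4⟩ := h'.exists_seq
  have h5 := (h1.sub h3).norm
  have h6 := (h2.sub h4).norm
  simp only [← map_sub] at h5 h6
  simp only [norm_linearCombination_eq_of_gram_eq hG] at h5
  have := tendsto_nhds_unique h5 h6
  rw [sub_self, norm_zero, eq_comm, norm_eq_zero] at this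
  exact sub_eq_zero.1 this

lemma exists_isCommonLimit [CompleteSpace E]
    (hG : ∀ k l, inner ℂ (e k) (e l) = inner ℂ (v k) (v l)) {J : Set ι} {η : E'}
    (hη : η ∈ (Submodule.span ℂ (v '' J)).topologicalClosure) :
    ∃ w ∈ (Submodule.span ℂ (e '' J)).topologicalClosure, IsCommonLimit e v w η := by
  choose p hpJ hp using fun n : ℕ =>
    mem_closure_span_image_iff.1 hη (1 / (n + 1)) Nat.one_div_pos_of_nat
  have hv : Tendsto (fun n => Finsupp.linearCombination ℂ v (p n)) atTop (𝓝 η) := by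
    rw [tendsto_iff_norm_sub_tendsto_zero]
    refine squeeze_zero (fun _ => norm_nonneg _) (fun n => ?_)
      tendsto_one_div_add_atTop_nhds_zero_nat
    rw [norm_sub_rev]; exact (hp n).le
  have hc : CauchySeq fun n => Finsupp.linearCombination ℂ e (p n) := by
    have := hv.cauchySeq
    rw [Metric.cauchySeq_iff] at this ⊢
    simpa only [dist_eq_norm, ← map_sub, norm_linearCombination_eq_of_gram_eq hG] using this
  obtain ⟨w, hw⟩ := cauchySeq_tendsto_of_complete hc
  have hlim : ∀ ε > 0, ∃ n, ‖w - Finsupp.linearCombination ℂ e (p n)‖ < ε ∧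
      ‖η - Finsupp.linearCombination ℂ v (p n)‖ < ε := fun ε hε => by
    have h1 := hw.eventually (Metric.ball_mem_nhds w hε)
    have h2 := hv.eventually (Metric.ball_mem_nhds η hε)
    obtain ⟨n, hn1, hn2⟩ := (h1.and h2).exists
    exact ⟨n, by rwa [← dist_eq_norm, dist_comm], by rwa [← dist_eq_norm, dist_comm]⟩
  refine ⟨w, mem_closure_span_image_iff.2 fun ε hε => ?_, fun ε hε => ?_⟩
  · obtain ⟨n, hn, -⟩ := hlim ε hε
    exact ⟨p n, hpJ n, hn⟩
  · obtain ⟨n, hn⟩ := hlim ε hε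
    exact ⟨p n, hn⟩

end CommonLimit

/-! ### The symbol of the functional -/

section Symbol

variable {T : ℕ} {a : ℕ → ℂ}

lemma coeffVec_natCast (n : ℕ) (ν : Fin T) : coeffVec T a n ν = a (n * T + ν + 1) := by
  simp [coeffVec]

lemma summable_norm_coeffVec (hT : 0 < T) (ha : Summable fun j : ℕ => ‖a (j + 1)‖) :
    Summable fun k : ℕ × Fin T => ‖coeffVec T a k.1 k.2‖ := by
  have : NeZero T := ⟨hT.ne'⟩
  refine (((Nat.divModEquiv T).symm.summable_iff).2 ha).congr fun k => ?_
  rw [coeffVec_natCast]; rfl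

lemma summable_norm_coeffVec_apply (hT : 0 < T) (ha : Summable fun j : ℕ => ‖a (j + 1)‖)
    (ν : Fin T) : Summable fun n : ℕ => ‖coeffVec T a n ν‖ :=
  (summable_norm_coeffVec hT ha).comp_injective (i := fun n : ℕ => (n, ν)) fun m n h => by
    simpa using h

lemma norm_coeffVec_mul_expI (n : ℕ) (ν : Fin T) (t : ℝ) :
    ‖coeffVec T a n ν * expI n t‖ = ‖coeffVec T a n ν‖ := by
  rw [norm_mul, norm_expI, mul_one]

lemma memLp_top_symbolA (hT : 0 < T) (ha : Summable fun j : ℕ => ‖a (j + 1)‖) :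
    MemLp (symbolA T a) ∞ normFreq := by
  refine memLp_pi_iff.2 fun ν => ?_
  have hs := summable_norm_coeffVec_apply hT ha ν
  have hc : Continuous fun t => symbolA T a t ν :=
    continuous_tsum (fun n => continuous_const.mul (continuous_expI n)) hs
      fun n t => (norm_coeffVec_mul_expI n ν t).le
  refine memLp_top_of_bound hc.aestronglyMeasurable (∑' n : ℕ, ‖coeffVec T a n ν‖)
    (.of_forall fun t => ?_)
  refine (norm_tsum_le_tsum_norm ?_).trans_eq (tsum_congr fun n => norm_coeffVec_mul_expI n ν t)
  exact hs.congr fun n => (norm_coeffVec_mul_expI n ν t).symm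

lemma memLp_symbolA (hT : 0 < T) (ha : Summable fun j : ℕ => ‖a (j + 1)‖) :
    MemLp (symbolA T a) 2 normFreq :=
  (memLp_top_symbolA hT ha).mono_exponent le_top

lemma inner_expL2_symbolA (hT : 0 < T) (ha : Summable fun j : ℕ => ‖a (j + 1)‖)
    (k : ℤ × Fin T) :
    inner ℂ (expL2 k) (toVec _ (memLp_symbolA hT ha)) = coeffVec T a k.1 k.2 := by
  rw [inner_expL2_toVec]
  have hs := summable_norm_coeffVec_apply hT ha k.2
  have e : ∀ (n : ℕ) (t : ℝ), coeffVec T a n k.2 * expI n t * expI (-k.1) t =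
      coeffVec T a n k.2 * expI (n + -k.1) t := fun n t => by rw [expI_add, mul_assoc]
  have hint : ∀ n : ℕ, Integrable
      (fun t => coeffVec T a n k.2 * expI n t * expI (-k.1) t) normFreq := fun n => by
    simp only [e]
    exact ((memLp_top_of_bound (continuous_expI _).aestronglyMeasurable 1
      (.of_forall fun t => (norm_expI _ t).le)).integrable le_top).const_mul _
  have h := hasSum_integral_of_summable_integral_norm hint (by
    simpa only [norm_mul, norm_expI, mul_one, integral_const, probReal_univ, one_smul] using hs)
  have h2 : ∀ t, ∑' n : ℕ, coeffVec T a n k.2 * expI n t * expI (-k.1) t =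
      symbolA T a t k.2 * expI (-k.1) t := fun t => tsum_mul_right
  simp only [h2] at h
  refine h.unique ?_
  have h3 : ∀ n : ℕ, ∫ t, coeffVec T a n k.2 * expI n t * expI (-k.1) t ∂normFreq =
      if (n : ℤ) = k.1 then coeffVec T a k.1 k.2 else 0 := fun n => by
    simp only [e]
    rw [integral_const_mul, integral_expI]
    by_cases hn : (n : ℤ) = k.1
    · rw [if_pos (by lia), if_pos hn, mul_one, hn]
    · rw [if_neg (by lia), if_neg hn, mul_zero]
  simp only [h3]
  by_cases hk : 0 ≤ k.1
  · convert hasSum_ite_eq k.1.toNat (coeffVec T a k.1 k.2) using 3 with n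
    all_goals lia
  · have : coeffVec T a k.1 k.2 = 0 := by simp [coeffVec, hk]
    simp only [this, ite_self]
    exact hasSum_zero

lemma symbolA_mem_freqSubspace (hT : 0 < T) (ha : Summable fun j : ℕ => ‖a (j + 1)‖)
    {Γ : Set ℤ} (hΓ : ∀ n, 0 ≤ n → n ∈ Γ) :
    toVec _ (memLp_symbolA hT ha) ∈ freqSubspace T Γ := by
  refine mem_freqSubspace.2 fun k hk => ?_
  rw [inner_expL2_symbolA hT ha, coeffVec, if_neg fun h => hk (hΓ _ h)]

lemma coeffs_symbolA (hT : 0 < T) (ha : Summable fun j : ℕ => ‖a (j + 1)‖) (Γ : Set ℤ) :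
    coeffs Γ (toVec _ (memLp_symbolA hT ha)) = coeffOn T a Γ := by
  funext n ν
  exact inner_expL2_symbolA hT ha _

lemma hasSum_symbolA (hT : 0 < T) (ha : Summable fun j : ℕ => ‖a (j + 1)‖) :
    HasSum (fun k : ℕ × Fin T => coeffVec T a k.1 k.2 • expL2 ((k.1 : ℤ), k.2))
      (toVec _ (memLp_symbolA hT ha)) := by
  have h := (expBasis T).hasSum_repr (toVec _ (memLp_symbolA hT ha))
  simp only [HilbertBasis.repr_apply_apply, coe_expBasis, inner_expL2_symbolA hT ha] at h
  have hi : Function.Injective fun k : ℕ × Fin T => ((k.1 : ℤ), k.2) := fun k l h => by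
    simp only [Prod.mk.injEq, Nat.cast_inj] at h
    exact Prod.ext h.1 h.2
  refine (hi.hasSum_iff fun k hk => ?_).2 h
  have : ¬ 0 ≤ k.1 := fun h0 => hk ⟨(k.1.toNat, k.2), Prod.ext (Int.toNat_of_nonneg h0) rfl⟩
  simp [coeffVec, this]

end Symbol

/-! ### The observed sequence in `L²(P)` -/

section Observations

variable {Ω : Type*} [MeasurableSpace Ω] {P : Measure Ω} {T : ℕ} {ζ θ : ℤ → Ω → ℂ}
  {f g : ℝ → Matrix (Fin T) (Fin T) ℂ} {a : ℕ → ℂ}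

lemma inner_toL2 (hζ : IsPeriodicallyCorrelated P T ζ) (hθ : IsPeriodicallyCorrelated P T θ)
    (m n : ℤ) : inner ℂ (hζ.toL2 m) (hθ.toL2 n) = ∫ ω, θ n ω * conj (ζ m ω) ∂P := by
  rw [L2.inner_def]
  refine integral_congr_ae ?_
  filter_upwards [(hζ.memLp m).coeFn_toLp, (hθ.memLp n).coeFn_toLp] with ω h1 h2
  rw [IsPeriodicallyCorrelated.toL2, IsPeriodicallyCorrelated.toL2, h1, h2, RCLike.inner_apply]

lemma inner_block_toL2 (hζ : IsPeriodicallyCorrelated P T ζ) (hf : IsSpectralDensity P ζ f)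
    (k l : ℤ × Fin T) :
    inner ℂ (block T hζ.toL2 k.1 k.2) (block T hζ.toL2 l.1 l.2) =
      ∫ t, expI (l.1 - k.1) t * f t l.2 k.2 ∂normFreq := by
  rw [integral_normFreq, ← hf.covariance]
  exact inner_toL2 hζ hζ _ _

lemma inner_block_observed (hζ : IsPeriodicallyCorrelated P T ζ)
    (hθ : IsPeriodicallyCorrelated P T θ) (hζθ : Uncorrelated P ζ θ)
    (hf : IsSpectralDensity P ζ f) (hg : IsSpectralDensity P θ g) (k l : ℤ × Fin T) :
    inner ℂ (block T (fun j => hζ.toL2 j + hθ.toL2 j) k.1 k.2)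
        (block T (fun j => hζ.toL2 j + hθ.toL2 j) l.1 l.2) =
      ∫ t, expI (l.1 - k.1) t * (f t + g t) l.2 k.2 ∂normFreq := by
  have h0 : ∀ m n, inner ℂ (hθ.toL2 m) (hζ.toL2 n) = 0 := fun m n => by
    rw [inner_toL2]; exact hζθ n m
  have h0' : ∀ m n, inner ℂ (hζ.toL2 m) (hθ.toL2 n) = 0 := fun m n => by
    rw [← inner_conj_symm, h0, map_zero]
  have e : ∀ n ν, block T (fun j => hζ.toL2 j + hθ.toL2 j) n ν =
    block T hζ.toL2 n ν + block T hθ.toL2 n ν := fun n ν => rfl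
  have e1 : inner ℂ (block T hζ.toL2 k.1 k.2) (block T hθ.toL2 l.1 l.2) = 0 := h0' _ _
  have e2 : inner ℂ (block T hθ.toL2 k.1 k.2) (block T hζ.toL2 l.1 l.2) = 0 := h0 _ _
  have hi : ∀ {φ : ℝ → ℂ}, Integrable φ freqMeasure →
      Integrable (fun t => expI (l.1 - k.1) t * φ t) normFreq := fun h =>
    (integrable_normFreq_iff.2 h).bdd_mul (c := 1) (continuous_expI _).aestronglyMeasurable
      (.of_forall fun t => (norm_expI _ t).le)
  rw [e, e, inner_add_left, inner_add_right, inner_add_right, e1, e2,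
    inner_block_toL2 hζ hf, inner_block_toL2 hθ hg, add_zero, zero_add,
    ← integral_add (hi (hf.integrable _ _)) (hi (hg.integrable _ _))]
  simp only [Matrix.add_apply, mul_add]

lemma exists_hasSum_functional (hT : 0 < T) (hζ : IsPeriodicallyCorrelated P T ζ)
    (hf : IsSpectralDensity P ζ f) (ha : Summable fun j : ℕ => ‖a (j + 1)‖) :
    ∃ Aζ : Lp ℂ 2 P, HasSum (fun j : ℕ => a (j + 1) • hζ.toL2 (j + 1)) Aζ ∧
      HasSum (fun k : ℕ × Fin T => coeffVec T a k.1 k.2 • block T hζ.toL2 k.1 k.2) Aζ := by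
  have : NeZero T := ⟨hT.ne'⟩
  -- the norms of the members of the sequence take at most `T` values
  have hn : ∀ (n : ℤ) (ν : Fin T), ‖block T hζ.toL2 n ν‖ = ‖block T hζ.toL2 0 ν‖ := fun n ν => by
    have h1 := inner_block_toL2 hζ hf (n, ν) (n, ν)
    have h2 := inner_block_toL2 hζ hf (0, ν) (0, ν)
    rw [sub_self] at h1 h2
    rw [@norm_eq_sqrt_re_inner ℂ, @norm_eq_sqrt_re_inner ℂ]
    exact congrArg _ (congrArg _ (h1.trans h2.symm))
  have hsum : Summable fun k : ℕ × Fin T =>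
      coeffVec T a k.1 k.2 • block T hζ.toL2 k.1 k.2 := by
    refine Summable.of_norm_bounded
      ((summable_norm_coeffVec hT ha).mul_right (∑ ν, ‖block T hζ.toL2 0 ν‖)) fun k => ?_
    rw [norm_smul, hn]
    gcongr
    exact Finset.single_le_sum (f := fun ν => ‖block T hζ.toL2 0 ν‖)
      (fun _ _ => norm_nonneg _) (Finset.mem_univ k.2)
  refine ⟨_, ?_, hsum.hasSum⟩
  rw [← (Nat.divModEquiv T).symm.hasSum_iff]
  refine hsum.hasSum.congr_fun fun k => ?_
  rw [coeffVec_natCast]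
  simp only [Function.comp_apply, block, Nat.divModEquiv_symm_apply]
  push_cast
  rfl

/-- The correlation of the functional with the members of the sequence, in spectral terms. -/
lemma inner_block_functional (hT : 0 < T) (hζ : IsPeriodicallyCorrelated P T ζ)
    (hf : IsSpectralDensity P ζ f) (ha : Summable fun j : ℕ => ‖a (j + 1)‖)
    (hf2 : ∀ i j, MemLp (fun t => f t i j) 2 normFreq)
    (hAf : MemLp (fun t => symbolA T a t ᵥ* f t) 2 normFreq) {Aζ : Lp ℂ 2 P}
    (hA : HasSum (fun k : ℕ × Fin T => coeffVec T a k.1 k.2 • block T hζ.toL2 k.1 k.2) Aζ)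
    (k : ℤ × Fin T) :
    inner ℂ (block T hζ.toL2 k.1 k.2) Aζ = inner ℂ (expL2 k) (toVec _ hAf) := by
  rw [inner_expL2_toVec, ← inner_toeplitzRow hf2 k (memLp_symbolA hT ha)]
  have h1 := hA.mapL (innerSL ℂ (block T hζ.toL2 k.1 k.2))
  have h2 := (hasSum_symbolA hT ha).mapL (innerSL ℂ (toeplitzRow f hf2 k))
  simp only [innerSL_apply_apply, inner_smul_right, inner_toeplitzRow_expL2,
    toeplitzBlock_apply] at h1 h2
  refine h1.unique (h2.congr_fun fun l => ?_)
  rw [inner_block_toL2 hζ hf k ((l.1 : ℤ), l.2)]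
  congr 1
  refine integral_congr_ae (.of_forall fun t => ?_)
  simp only [neg_sub]
  ring

lemma inner_block_observed_functional (hζ : IsPeriodicallyCorrelated P T ζ)
    (hθ : IsPeriodicallyCorrelated P T θ) (hζθ : Uncorrelated P ζ θ) {Aζ : Lp ℂ 2 P}
    (hA : HasSum (fun k : ℕ × Fin T => coeffVec T a k.1 k.2 • block T hζ.toL2 k.1 k.2) Aζ)
    (k : ℤ × Fin T) :
    inner ℂ (block T (fun j => hζ.toL2 j + hθ.toL2 j) k.1 k.2) Aζ =
      inner ℂ (block T hζ.toL2 k.1 k.2) Aζ := by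
  have e : block T (fun j => hζ.toL2 j + hθ.toL2 j) k.1 k.2 =
    block T hζ.toL2 k.1 k.2 + block T hθ.toL2 k.1 k.2 := rfl
  rw [e, inner_add_left, add_eq_left]
  have h := hA.mapL (innerSL ℂ (block T hθ.toL2 k.1 k.2))
  refine h.unique (hasSum_zero.congr_fun fun l => ?_)
  rw [innerSL_apply_apply, inner_smul_right]
  have : inner ℂ (block T hθ.toL2 k.1 k.2) (block T hζ.toL2 l.1 l.2) = 0 :=
    (inner_toL2 hθ hζ _ _).trans (hζθ _ _)
  rw [this, mul_zero]

lemma inner_functional_self (hT : 0 < T) (hζ : IsPeriodicallyCorrelated P T ζ)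
    (hf : IsSpectralDensity P ζ f) (ha : Summable fun j : ℕ => ‖a (j + 1)‖)
    (hf2 : ∀ i j, MemLp (fun t => f t i j) 2 normFreq)
    (hAf : MemLp (fun t => symbolA T a t ᵥ* f t) 2 normFreq) {Aζ : Lp ℂ 2 P}
    (hA : HasSum (fun k : ℕ × Fin T => coeffVec T a k.1 k.2 • block T hζ.toL2 k.1 k.2) Aζ) :
    inner ℂ Aζ Aζ = inner ℂ (toVec _ hAf) (toVec _ (memLp_symbolA hT ha)) := by
  have h1 := hA.mapL (innerSL ℂ Aζ)
  have h2 := (hasSum_symbolA hT ha).mapL (innerSL ℂ (toVec _ hAf))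
  simp only [innerSL_apply_apply, inner_smul_right] at h1 h2
  refine h1.unique (h2.congr_fun fun l => ?_)
  rw [← inner_conj_symm, inner_block_functional hT hζ hf ha hf2 hAf hA ((l.1 : ℤ), l.2),
    inner_conj_symm]

/-! ### Index sets -/

lemma mem_gammaSet_of_nonneg (s : ℕ) (N K : ℕ → ℕ) (n : ℤ) (hn : 0 ≤ n) :
    n ∈ gammaSet s N K := Or.inr hn

lemma notMem_gammaSet_iff (s : ℕ) (N K : ℕ → ℕ) (n : ℤ) :
    n ∉ gammaSet s N K ↔ n ≤ -1 ∧ n ∉ blockGapSet s N K := by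
  simp only [gammaSet, mem_union, mem_ofPred_eq, not_or, not_le]
  constructor <;> rintro ⟨h1, h2⟩ <;> exact ⟨by lia, by lia⟩

lemma zero_le_mul_add_iff {x : ℤ} (ν : Fin T) : 0 ≤ x * T + (ν : ℕ) ↔ 0 ≤ x := by
  have h1 : ((ν : ℕ) : ℤ) < T := by exact_mod_cast ν.2
  constructor
  · intro h
    by_contra hx
    have : (x + 1) * (T : ℤ) ≤ 0 := mul_nonpos_of_nonpos_of_nonneg (by lia) (by lia)
    rw [add_mul] at this
    lia
  · intro h
    positivity

lemma mem_gapSet_iff (s : ℕ) (N K : ℕ → ℕ) (n : ℤ) (ν : Fin T) :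
    n * T + ((ν : ℕ) : ℤ) + 1 ∈ gapSet T s N K ↔ n ∈ blockGapSet s N K := by
  refine exists_congr fun l => and_congr_right fun _ => and_congr_right fun _ => and_congr ?_ ?_
  · have := zero_le_mul_add_iff (x := n + gapM N K l) ν
    rw [add_mul] at this
    constructor <;> intro h
    · have := this.1 (by lia); lia
    · have := this.2 (by lia); lia
  · have := zero_le_mul_add_iff (x := n + gapM N K (l - 1) + N l) ν
    rw [add_mul, add_mul] at this
    constructor <;> intro h
    · by_contra h'; have := this.2 (by lia); lia
    · by_contra h'; have := this.1 (by lia); lia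

/-- The observed indices are those in the blocks outside `Γ`. -/
lemma observationSpace_eq (hT : 0 < T) (X : ℤ → Lp ℂ 2 P) (s : ℕ) (N K : ℕ → ℕ) :
    observationSpace X (gapSet T s N K) =
      (Submodule.span ℂ ((fun k : ℤ × Fin T => block T X k.1 k.2) ''
        {k | k.1 ≤ -1 ∧ k.1 ∉ blockGapSet s N K})).topologicalClosure := by
  have hneg : ∀ (n : ℤ) (ν : Fin T), n * T + ((ν : ℕ) : ℤ) + 1 ≤ 0 ↔ n ≤ -1 := fun n ν => by
    have := zero_le_mul_add_iff (x := n) ν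
    lia
  have : X '' {j | j ≤ 0 ∧ j ∉ gapSet T s N K} = (fun k : ℤ × Fin T => block T X k.1 k.2) ''
        {k | k.1 ≤ -1 ∧ k.1 ∉ blockGapSet s N K} := by
    ext x
    constructor
    · rintro ⟨j, ⟨hj, hjS⟩, rfl⟩
      have hT' : (0 : ℤ) < T := by exact_mod_cast hT
      have hν := Int.emod_nonneg (j - 1) hT'.ne'
      have hν' := Int.emod_lt_of_pos (j - 1) hT'
      have e : j = (j - 1) / T * T + ((j - 1) % T).toNat + 1 := by
        rw [Int.toNat_of_nonneg hν]
        have := Int.mul_ediv_add_emod (j - 1) T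
        linarith
      let ν : Fin T := ⟨((j - 1) % T).toNat, by lia⟩
      have e' : j = (j - 1) / T * T + ((ν : ℕ) : ℤ) + 1 := e
      refine ⟨((j - 1) / T, ν), ⟨?_, ?_⟩, ?_⟩
      · rw [e', hneg] at hj; exact hj
      · rw [e', mem_gapSet_iff] at hjS; exact hjS
      · exact congrArg X e'.symm
    · rintro ⟨⟨n, ν⟩, ⟨hn, hnG⟩, rfl⟩
      exact ⟨_, ⟨(hneg n ν).2 hn, fun h => hnG ((mem_gapSet_iff s N K n ν).1 h)⟩, rfl⟩
  rw [observationSpace, this]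

lemma meanSquare_eq (ξ η : Lp ℂ 2 P) : meanSquare ξ η = ‖ξ - η‖ ^ 2 := by
  rw [← inner_self_eq_norm_sq (𝕜 := ℂ), L2.inner_def, ← integral_re (L2.integrable_inner _ _)]
  refine integral_congr_ae ?_
  filter_upwards [Lp.coeFn_sub ξ η] with ω h
  rw [h, Pi.sub_apply, inner_self_eq_norm_sq]

end Observations

/-! ### Projections and spectral error -/

section Projection

variable {E : Type*} [NormedAddCommGroup E] [InnerProductSpace ℂ E]

lemma inner_eq_zero_of_mem_closure_span {S : Set E} {u x : E}
    (hx : x ∈ (Submodule.span ℂ S).topologicalClosure) (h : ∀ y ∈ S, inner ℂ y u = 0) :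
    inner ℂ x u = 0 := by
  have hle : (Submodule.span ℂ S).topologicalClosure ≤ (ℂ ∙ u)ᗮ := by
    refine Submodule.topologicalClosure_minimal _ (Submodule.span_le.2 fun y hy => ?_)
      (Submodule.isClosed_orthogonal _)
    exact Submodule.mem_orthogonal_singleton_iff_inner_left.2 (h y hy)
  exact Submodule.mem_orthogonal_singleton_iff_inner_left.1 (hle hx)

lemma norm_sub_sq_of_inner_eq_zero {x w w₀ : E} (h : inner ℂ (x - w) (w₀ - w) = 0) :
    ‖x - w₀‖ ^ 2 = ‖x - w‖ ^ 2 + ‖w₀ - w‖ ^ 2 := by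
  have := @norm_sub_sq ℂ _ _ _ _ (x - w) (w₀ - w)
  rw [sub_sub_sub_cancel_right, h] at this
  simpa using this

lemma isOptimalEstimate_iff {Ω : Type*} [MeasurableSpace Ω] {P : Measure Ω}
    {H : Submodule ℂ (Lp ℂ 2 P)} {ξ η : Lp ℂ 2 P} (hη : η ∈ H)
    (horth : ∀ x ∈ H, inner ℂ x (ξ - η) = 0) (η' : Lp ℂ 2 P) :
    IsOptimalEstimate H ξ η' ↔ η' = η := by
  have key : ∀ x ∈ H, meanSquare ξ x = ‖x - η‖ ^ 2 + meanSquare ξ η := fun x hx => by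
    rw [meanSquare_eq, meanSquare_eq, norm_sub_rev,
      norm_sub_sq_of_inner_eq_zero (horth _ (H.sub_mem hx hη))]
  constructor
  · rintro ⟨h1, h2⟩
    have h3 := h2 η hη
    rw [key η' h1] at h3
    have h4 : ‖η' - η‖ ^ 2 = 0 := le_antisymm (by linarith) (by positivity)
    exact sub_eq_zero.1 (norm_eq_zero.1 (pow_eq_zero_iff two_ne_zero |>.1 h4))
  · rintro rfl
    refine ⟨hη, fun x hx => ?_⟩
    rw [key x hx]
    linarith [sq_nonneg ‖x - η'‖]

end Projection

section SpectralError

variable {T : ℕ} {a : ℕ → ℂ} {f g Q : ℝ → Matrix (Fin T) (Fin T) ℂ}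

lemma dotProduct_star_comm_re (x y : Fin T → ℂ) : (x ⬝ᵥ star y).re = (y ⬝ᵥ star x).re := by
  rw [Matrix.dotProduct_star y x]; simp

/-- Completion of the square in the mean-square error, at a fixed frequency. -/
lemma quadForm_sub_add_quadForm {f g Q : Matrix (Fin T) (Fin T) ℂ} (hf : f.IsHermitian)
    (hQ : Q.IsHermitian) (hQF : Q * Q = f + g) (hu : IsUnit Q.det) (A h : Fin T → ℂ) :
    (quadForm f (A - h)).re + (quadForm g h).re = (quadForm f A).re -
      (((A ᵥ* f) ᵥ* Q⁻¹) ⬝ᵥ star ((A ᵥ* f) ᵥ* Q⁻¹)).re +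
      ((h ᵥ* Q - (A ᵥ* f) ᵥ* Q⁻¹) ⬝ᵥ star (h ᵥ* Q - (A ᵥ* f) ᵥ* Q⁻¹)).re := by
  set w := (A ᵥ* f) ᵥ* Q⁻¹ with hw
  have h1 : (h ᵥ* f) ⬝ᵥ star h + quadForm g h = (h ᵥ* Q) ⬝ᵥ star (h ᵥ* Q) := by
    rw [← quadForm_eq_of_isHermitian hQ, hQF, quadForm, quadForm, Matrix.vecMul_add,
      add_dotProduct]
  have h2 : (A ᵥ* f) ⬝ᵥ star h = w ⬝ᵥ star (h ᵥ* Q) := by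
    have e := vecMul_dotProduct_star w h Q
    rw [hQ.eq] at e
    rw [← e, hw, Matrix.vecMul_vecMul, Matrix.nonsing_inv_mul _ hu, Matrix.vecMul_one]
  have h3 : ((h ᵥ* f) ⬝ᵥ star A).re = (w ⬝ᵥ star (h ᵥ* Q)).re := by
    rw [vecMul_dotProduct_star, hf.eq, dotProduct_star_comm_re, h2]
  have h4 := dotProduct_star_comm_re (h ᵥ* Q) w
  have h1' := congrArg Complex.re h1
  have h2' := congrArg Complex.re h2
  simp only [quadForm, Matrix.sub_vecMul, star_sub, sub_dotProduct, dotProduct_sub,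
    Complex.sub_re, Complex.add_re] at *
  linarith

/-- The mean-square error as a squared distance in `L2Vec T`. -/
lemma spectralError_eq (hT : 0 < T) (ha : Summable fun j : ℕ => ‖a (j + 1)‖)
    (hreg : IsRegularPair f g) (hQ : IsDensitySqrt (fun t => f t + g t) Q)
    (hAf : MemLp (fun t => symbolA T a t ᵥ* f t) 2 normFreq)
    (hw : MemLp (fun t => (symbolA T a t ᵥ* f t) ᵥ* (Q t)⁻¹) 2 normFreq) {h : ℝ → Fin T → ℂ}
    (hh : MemLp (fun t => h t ᵥ* Q t) 2 normFreq) :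
    spectralError a f g h =
      (inner ℂ (toVec _ (memLp_symbolA hT ha)) (toVec _ hAf) : ℂ).re - ‖toVec _ hw‖ ^ 2 +
        ‖toVec _ hh - toVec _ hw‖ ^ 2 := by
  have hhm := aestronglyMeasurable_normFreq_iff.2 (hQ.memL2Density_iff.2 hh).1
  have hIA : Integrable (fun t => (quadForm (f t) (symbolA T a t)).re) normFreq :=
    (integrable_dotProduct_star (memLp_symbolA hT ha) hAf).re
  have hIw : Integrable (fun t => (((symbolA T a t ᵥ* f t) ᵥ* (Q t)⁻¹) ⬝ᵥ
      star ((symbolA T a t ᵥ* f t) ᵥ* (Q t)⁻¹)).re) normFreq :=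
    (integrable_dotProduct_star hw hw).re
  have hId : Integrable (fun t => ((h t ᵥ* Q t - (symbolA T a t ᵥ* f t) ᵥ* (Q t)⁻¹) ⬝ᵥ
      star (h t ᵥ* Q t - (symbolA T a t ᵥ* f t) ᵥ* (Q t)⁻¹)).re) normFreq :=
    (integrable_dotProduct_star (hh.sub hw) (hh.sub hw)).re
  have hIg : Integrable (fun t => (quadForm (g t) (h t)).re) normFreq := by
    refine (integrable_dotProduct_star hh hh).re.mono'
      (aestronglyMeasurable_quadForm hhm fun i j => (hreg.bddg i j).1).re ?_
    filter_upwards [hreg.posf, hreg.posg, hQ.quadForm_eq] with t h1 h2 h3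
    have h4 := (Complex.nonneg_iff.1 (quadForm_nonneg h1 (h t))).1
    have h5 := (Complex.nonneg_iff.1 (quadForm_nonneg h2 (h t))).1
    have h6 : quadForm (f t + g t) (h t) = quadForm (f t) (h t) + quadForm (g t) (h t) := by
      rw [quadForm, Matrix.vecMul_add, add_dotProduct]; rfl
    have h7 := congrArg Complex.re (h6.symm.trans (h3 (h t)))
    rw [Complex.add_re] at h7
    rw [Real.norm_of_nonneg h5]
    simp only [RCLike.re_to_complex]
    linarith
  have hpt : ∀ᵐ t ∂normFreq, (quadForm (f t) (symbolA T a t - h t)).re =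
      (quadForm (f t) (symbolA T a t)).re -
      (((symbolA T a t ᵥ* f t) ᵥ* (Q t)⁻¹) ⬝ᵥ star ((symbolA T a t ᵥ* f t) ᵥ* (Q t)⁻¹)).re +
      ((h t ᵥ* Q t - (symbolA T a t ᵥ* f t) ᵥ* (Q t)⁻¹) ⬝ᵥ
        star (h t ᵥ* Q t - (symbolA T a t ᵥ* f t) ᵥ* (Q t)⁻¹)).re -
      (quadForm (g t) (h t)).re := by
    filter_upwards [hreg.posf, hQ.ae] with t h1 h2
    have := quadForm_sub_add_quadForm h1.isHermitian h2.1 h2.2.1 h2.2.2 (symbolA T a t) (h t)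
    linarith
  have hsplit : ∀ {φ₁ φ₂ φ₃ φ₄ : ℝ → ℝ}, Integrable φ₁ normFreq → Integrable φ₂ normFreq →
      Integrable φ₃ normFreq → Integrable φ₄ normFreq →
      ∫ t, φ₁ t - φ₂ t + φ₃ t - φ₄ t ∂normFreq = ∫ t, φ₁ t ∂normFreq - ∫ t, φ₂ t ∂normFreq +
        ∫ t, φ₃ t ∂normFreq - ∫ t, φ₄ t ∂normFreq := fun h₁ h₂ h₃ h₄ => by
    have e₁ := integral_sub h₁ h₂
    have e₂ := integral_add (h₁.sub h₂) h₃
    have e₃ := integral_sub ((h₁.sub h₂).add h₃) h₄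
    simp only [Pi.add_apply, Pi.sub_apply] at e₂ e₃
    linarith
  rw [spectralError, sqNormDensity, sqNormDensity, ← integral_normFreq_real,
    ← integral_normFreq_real, integral_congr_ae hpt, toVec_sub, norm_sq_toVec, norm_sq_toVec,
    hsplit hIA hIw hId hIg, inner_toVec]
  have := integral_re (integrable_dotProduct_star (memLp_symbolA hT ha) hAf)
  simp only [RCLike.re_to_complex] at this
  rw [← this]
  simp only [quadForm]
  ring

lemma ofReal_norm_toVec {b : ℝ → Fin T → ℂ} (hb : MemLp b 2 normFreq) :
    ENNReal.ofReal ‖toVec b hb‖ = eLpNorm (fun t => WithLp.toLp 2 (b t)) 2 normFreq := by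
  rw [toVec, Lp.norm_toLp, ENNReal.ofReal_toReal (memLp_toLp hb).2.ne]

lemma isFourierSum_coeffs {Γ : Set ℤ} {C : ℝ → Fin T → ℂ} (hC : MemLp C 2 normFreq)
    (hΓ : toVec C hC ∈ freqSubspace T Γ) : IsFourierSum (coeffs Γ (toVec C hC)) C := by
  have hfreq : freqMeasure = ENNReal.ofReal (2 * π) • normFreq := by
    rw [normFreq, smul_smul, ← ENNReal.ofReal_mul (by positivity), mul_one_div_cancel
      (by positivity), ENNReal.ofReal_one, one_smul]
  refine ⟨hfreq ▸ hC.smul_measure ENNReal.ofReal_ne_top, ?_⟩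
  have hsum : ∀ s : Finset Γ, ∃ h : MemLp (fun t => ∑ n ∈ s, expI n t • coeffs Γ (toVec C hC) n) 2
      normFreq, ∑ n ∈ s, ∑ ν, coeffs Γ (toVec C hC) n ν • expL2 ((n : ℤ), ν) = toVec _ h := by
    intro s
    let p : (ℤ × Fin T) →₀ ℂ :=
      ∑ n ∈ s, ∑ ν, Finsupp.single ((n : ℤ), ν) (coeffs Γ (toVec C hC) n ν)
    obtain ⟨h1, e1⟩ := linearCombination_toVec memLp_expVec p
    have e : (fun t => p.sum fun k z => z • expVec k t) =
        fun t => ∑ n ∈ s, expI n t • coeffs Γ (toVec C hC) n := by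
      funext t
      change Finsupp.linearCombination ℂ (fun k => expVec k t) p = _
      simp only [p, map_sum, Finsupp.linearCombination_single]
      refine Finset.sum_congr rfl fun n _ => ?_
      funext μ
      simp [expVec, Finset.sum_apply, Pi.single_apply, mul_comm]
    simp only [e] at h1 e1
    refine ⟨h1, ?_⟩
    rw [← e1]
    simp only [p, map_sum, Finsupp.linearCombination_single]
    rfl
  have h0 := tendsto_iff_norm_sub_tendsto_zero.1 (hasSum_coeffs hΓ)
  have h1 := (ENNReal.tendsto_ofReal h0)
  have h2 := ENNReal.Tendsto.const_mul (a := ENNReal.ofReal (2 * π) ^ (1 / (2 : ℝ≥0∞)).toReal) h1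
    (Or.inr (ENNReal.rpow_ne_top_of_nonneg (by positivity) ENNReal.ofReal_ne_top))
  rw [ENNReal.ofReal_zero, mul_zero] at h2
  refine tendsto_of_tendsto_of_tendsto_of_le_of_le tendsto_const_nhds h2 (fun _ => zero_le) ?_
  intro s
  obtain ⟨hm, e⟩ := hsum s
  beta_reduce
  rw [hfreq, eLpNorm_smul_measure_of_ne_top (by norm_num), smul_eq_mul]
  gcongr
  rw [e, norm_sub_rev, toVec_sub, ofReal_norm_toVec]
  refine eLpNorm_mono fun t => (pi_norm_le_iff_of_nonneg (norm_nonneg _)).2 fun ν => ?_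
  exact PiLp.norm_apply_le (WithLp.toLp 2 _) ν

end SpectralError

/-! ### The optimal estimate -/

section Solution

variable {T : ℕ} {a : ℕ → ℂ} {f g F Q : ℝ → Matrix (Fin T) (Fin T) ℂ}

/-- The functions `e^{i n t} δ_ν Q⁻¹`; they are biorthogonal to the functions `e^{i n t} δ_ν Q`. -/
noncomputable def IsDensitySqrt.dualL2 (hQ : IsDensitySqrt F Q) (k : ℤ × Fin T) : L2Vec T :=
  toVec (fun t => expVec k t ᵥ* (Q t)⁻¹) (memLp_expVec_vecMul hQ.inv k)

lemma IsDensitySqrt.inner_dualL2 (hQ : IsDensitySqrt F Q) (k : ℤ × Fin T) {b : ℝ → Fin T → ℂ}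
    (hb : MemLp b 2 normFreq) :
    inner ℂ (hQ.dualL2 k) (toVec b hb) =
      ∫ t, (b t ᵥ* (Q t)⁻¹) k.2 * expI (-k.1) t ∂normFreq := by
  rw [IsDensitySqrt.dualL2, inner_toVec]
  refine integral_congr_ae ?_
  filter_upwards [hQ.ae] with t ht
  rw [← dotProduct_star_expVec, vecMul_dotProduct_star, ht.1.inv.eq]

lemma IsDensitySqrt.inner_dualL2_expL2 (hQ : IsDensitySqrt F Q) {k l : ℤ × Fin T} (h : k ≠ l) :
    inner ℂ (hQ.dualL2 k) (hQ.expL2 l) = 0 := by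
  rw [IsDensitySqrt.expL2, hQ.inner_dualL2, ← orthonormal_expL2.2 h, _root_.expL2.eq_def l,
    inner_expL2_toVec]
  refine integral_congr_ae ?_
  filter_upwards [hQ.ae] with t ht
  rw [Matrix.vecMul_vecMul, Matrix.mul_nonsing_inv _ ht.2.2, Matrix.vecMul_one]

lemma IsDensitySqrt.eq_of_toVec_eq (hQ : IsDensitySqrt F Q) {b b' : ℝ → Fin T → ℂ}
    (hb : MemLp (fun t => b t ᵥ* Q t) 2 normFreq)
    (hb' : MemLp (fun t => b' t ᵥ* Q t) 2 normFreq) (h : toVec _ hb = toVec _ hb') :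
    b =ᵐ[freqMeasure] b' := by
  refine ae_normFreq_iff.1 ?_
  filter_upwards [(toVec_eq_iff hb hb').1 h, hQ.ae] with t ht hu
  have := congrArg (· ᵥ* (Q t)⁻¹) ht
  simpa only [Matrix.vecMul_vecMul, Matrix.mul_nonsing_inv _ hu.2.2, Matrix.vecMul_one] using this

/-- A function of `L₂ˢ(f + g)` for which `w₀ - w` is orthogonal to `L₂ˢ(f + g)` is the unique
minimiser of the spectral error. -/
lemma isOptimalCharacteristic_iff (hT : 0 < T) (ha : Summable fun j : ℕ => ‖a (j + 1)‖)
    (hreg : IsRegularPair f g) (hQ : IsDensitySqrt (fun t => f t + g t) Q)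
    (hAf : MemLp (fun t => symbolA T a t ᵥ* f t) 2 normFreq)
    (hw₀ : MemLp (fun t => (symbolA T a t ᵥ* f t) ᵥ* (Q t)⁻¹) 2 normFreq) {G : Set ℤ}
    {h₀ : ℝ → Fin T → ℂ} (hh₀ : MemLp (fun t => h₀ t ᵥ* Q t) 2 normFreq)
    (hmem : toVec _ hh₀ ∈ (Submodule.span ℂ
        (hQ.expL2 '' {k | k.1 ≤ -1 ∧ k.1 ∉ G})).topologicalClosure)
    (horth : ∀ x ∈ (Submodule.span ℂ
        (hQ.expL2 '' {k | k.1 ≤ -1 ∧ k.1 ∉ G})).topologicalClosure,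
      inner ℂ x (toVec _ hw₀ - toVec _ hh₀) = 0) (h : ℝ → Fin T → ℂ) :
    IsOptimalCharacteristic a f g G h ↔ h =ᵐ[freqMeasure] h₀ := by
  have key : ∀ {b : ℝ → Fin T → ℂ} (hb : MemLp (fun t => b t ᵥ* Q t) 2 normFreq),
      toVec _ hb ∈ (Submodule.span ℂ
        (hQ.expL2 '' {k | k.1 ≤ -1 ∧ k.1 ∉ G})).topologicalClosure →
      spectralError a f g b = spectralError a f g h₀ + ‖toVec _ hb - toVec _ hh₀‖ ^ 2 := by
    intro b hb hbm
    rw [spectralError_eq hT ha hreg hQ hAf hw₀ hb, spectralError_eq hT ha hreg hQ hAf hw₀ hh₀,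
      norm_sub_sq_of_inner_eq_zero (horth _ (Submodule.sub_mem _ hbm hmem)),
      norm_sub_rev (toVec _ hh₀)]
    ring
  constructor
  · rintro ⟨h1, h2⟩
    obtain ⟨hb, hbm⟩ := hQ.memL2Observed_iff.1 h1
    have h3 := h2 h₀ (hQ.memL2Observed_iff.2 ⟨hh₀, hmem⟩)
    rw [key hb hbm] at h3
    have h4 : ‖toVec _ hb - toVec _ hh₀‖ ^ 2 = 0 := le_antisymm (by linarith) (by positivity)
    exact hQ.eq_of_toVec_eq hb hh₀
      (sub_eq_zero.1 (norm_eq_zero.1 (pow_eq_zero_iff two_ne_zero |>.1 h4)))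
  · intro he
    have he' : (fun t => h₀ t ᵥ* Q t) =ᵐ[normFreq] fun t => h t ᵥ* Q t := by
      filter_upwards [ae_normFreq_iff.2 he] with t ht
      rw [ht]
    have hb := hh₀.ae_eq he'
    have e : toVec _ hb = toVec _ hh₀ := ((toVec_eq_iff hh₀ hb).2 he').symm
    refine ⟨hQ.memL2Observed_iff.2 ⟨hb, e ▸ hmem⟩, fun h' hh' => ?_⟩
    obtain ⟨hb', hbm'⟩ := hQ.memL2Observed_iff.1 hh'
    rw [key hb (e ▸ hmem), key hb' hbm', e, sub_self, norm_zero]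
    have := sq_nonneg ‖toVec _ hb' - toVec _ hh₀‖
    linarith

end Solution

theorem mainTheorem1 {Ω : Type*} [MeasurableSpace Ω] (P : Measure Ω) [IsProbabilityMeasure P]
    (T : ℕ) (hT : 0 < T) (ζ θ : ℤ → Ω → ℂ)
    (hζ : IsPeriodicallyCorrelated P T ζ) (hθ : IsPeriodicallyCorrelated P T θ)
    (hζθ : Uncorrelated P ζ θ)
    (f g : ℝ → Matrix (Fin T) (Fin T) ℂ)
    (hf : IsSpectralDensity P ζ f) (hg : IsSpectralDensity P θ g)
    (hmin : MinimalityCondition f g)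
    (s : ℕ) (N K : ℕ → ℕ)
    (a : ℕ → ℂ) (ha : Summable fun j : ℕ => ‖a (j + 1)‖)
    (hB : BlockInvertible (blockB f g) (gammaSet s N K)) :
    -- the vectors `𝐑𝐚`, `𝐜`, `𝐃𝐚`, the function `C`, the functional `Aζ`, its optimal linear
    -- estimate `η`, and the scalar products `⟨𝐃𝐚, 𝐚⟩`, `⟨𝐁𝐜, 𝐜⟩`
    ∃ (Ra c Da : gammaSet s N K → Fin T → ℂ) (C : ℝ → Fin T → ℂ) (Aζ η : Lp ℂ 2 P)
      (dA dC : ℂ),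
      HasSum (fun j : ℕ => a (j + 1) • hζ.toL2 (j + 1)) Aζ ∧
      -- `𝐜 = 𝐁⁻¹ 𝐑 𝐚`
      BlockApply (blockR f g) (gammaSet s N K) (coeffOn T a _) Ra ∧ Memℓp Ra 2 ∧
      Memℓp c 2 ∧ BlockApply (blockB f g) (gammaSet s N K) c Ra ∧
      (∀ c', Memℓp c' 2 → BlockApply (blockB f g) (gammaSet s N K) c' Ra → c' = c) ∧
      IsFourierSum c C ∧
      -- the spectral characteristic of the optimal estimate, in both forms
      (∀ h, IsOptimalCharacteristic a f g (blockGapSet s N K) h ↔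
        h =ᵐ[freqMeasure] spectralChar a f g C) ∧
      (∀ᵐ t ∂freqMeasure, spectralChar a f g C t =
        symbolA T a t - (symbolA T a t ᵥ* g t + C t) ᵥ* (f t + g t)⁻¹) ∧
      -- the optimal estimate is the spectral integral of the spectral characteristic
      (∀ η', IsOptimalEstimate
          (observationSpace (fun j => hζ.toL2 j + hθ.toL2 j) (gapSet T s N K)) Aζ η' ↔ η' = η) ∧
      (∀ η', IsSpectralIntegral (fun j => hζ.toL2 j + hθ.toL2 j) (fun t => f t + g t)
          (spectralChar a f g C) η' ↔ η' = η) ∧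
      -- the mean-square error is `⟨𝐃𝐚, 𝐚⟩ + ⟨𝐁𝐜, 𝐜⟩`, where `𝐁𝐜 = 𝐑𝐚`
      BlockApply (blockD f g) (gammaSet s N K) (coeffOn T a _) Da ∧
      HasScalarProduct Da (coeffOn T a _) dA ∧ HasScalarProduct Ra c dC ∧
      ((meanSquare Aζ η : ℝ) : ℂ) = dA + dC ∧
      ((spectralError a f g (spectralChar a f g C) : ℝ) : ℂ) = dA + dC := by
  have hΓ := mem_gammaSet_of_nonneg s N K
  set Γ := gammaSet s N K
  have hreg := isRegularPair_of_blockInvertible hf.integrable hg.integrable hf.posSemidef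
    hg.posSemidef hmin hΓ hB
  obtain ⟨Q, hQ⟩ := hreg.exists_sqrt
  -- products with `f`, `g`, `(f + g)⁻¹`
  have hf2 : ∀ i j, MemLp (fun t => f t i j) 2 normFreq := fun i j =>
    (hreg.bddf i j).mono_exponent le_top
  have hA := memLp_symbolA hT ha
  have hAf' : MemLp (fun t => symbolA T a t ᵥ* f t) ∞ normFreq :=
    memLp_vecMul (p := ∞) (q := ∞) (memLp_top_symbolA hT ha) hreg.bddf
  have hAf : MemLp (fun t => symbolA T a t ᵥ* f t) 2 normFreq := hAf'.mono_exponent le_top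
  have hw₀ : MemLp (fun t => (symbolA T a t ᵥ* f t) ᵥ* (Q t)⁻¹) 2 normFreq :=
    memLp_vecMul (p := ∞) hAf' hQ.inv
  have hR : ∀ i j, MemLp (fun t => (f t * (f t + g t)⁻¹) i j) 2 normFreq :=
    memLp_matrix_mul (p := ∞) hreg.bddf hreg.inv
  have hD : ∀ i j, MemLp (fun t => (f t * (f t + g t)⁻¹ * g t) i j) 2 normFreq :=
    memLp_matrix_mul (q := ∞) hR hreg.bddg
  have hr : MemLp (fun t => symbolA T a t ᵥ* (f t * (f t + g t)⁻¹)) 2 normFreq :=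
    memLp_vecMul (p := ∞) (memLp_top_symbolA hT ha) hR
  have hd : MemLp (fun t => symbolA T a t ᵥ* (f t * (f t + g t)⁻¹ * g t)) 2 normFreq :=
    memLp_vecMul (p := ∞) (memLp_top_symbolA hT ha) hD
  -- the observed sequence and the functions `e^{i n t} δ_ν Q` have the same Gram matrix
  set X : ℤ → Lp ℂ 2 P := fun j => hζ.toL2 j + hθ.toL2 j
  have hG : ∀ k l, inner ℂ (hQ.expL2 k) (hQ.expL2 l) =
      inner ℂ (block T X k.1 k.2) (block T X l.1 l.2) := fun k l => by
    rw [hQ.inner_expL2_expL2, inner_block_observed hζ hθ hζθ hf hg]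
  obtain ⟨Aζ, hAζ, hAζ'⟩ := exists_hasSum_functional hT hζ hf ha
  set J : Set (ℤ × Fin T) := {k | k.1 ≤ -1 ∧ k.1 ∉ blockGapSet s N K}
  set H := (Submodule.span ℂ ((fun k : ℤ × Fin T => block T X k.1 k.2) '' J)).topologicalClosure
  have : CompleteSpace H := (Submodule.isClosed_topologicalClosure _).completeSpace_coe
  set η := H.starProjection Aζ
  have hηH : η ∈ H := Submodule.starProjection_apply_mem _ _
  have hηo : ∀ x ∈ H, inner ℂ x (Aζ - η) = 0 := fun x hx => by
    rw [← inner_conj_symm, Submodule.starProjection_inner_eq_zero _ _ hx, map_zero]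
  obtain ⟨w, hwmem, hwη⟩ := exists_isCommonLimit hG hηH
  obtain ⟨b, hb, rfl⟩ := exists_toVec w
  -- `w₀ = Aᵀ f Q⁻¹` correlates with the functions `e^{i n t} δ_ν Q` as `Aζ` with the observations
  have hEw₀ : ∀ k, inner ℂ (hQ.expL2 k) (toVec _ hw₀) = inner ℂ (block T X k.1 k.2) Aζ := by
    intro k
    rw [inner_block_observed_functional hζ hθ hζθ hAζ' k,
      inner_block_functional hT hζ hf ha hf2 hAf hAζ' k, hQ.inner_expL2, inner_expL2_toVec]
    refine integral_congr_ae ?_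
    filter_upwards [hQ.ae] with t ht
    rw [Matrix.vecMul_vecMul, Matrix.nonsing_inv_mul _ ht.2.2, Matrix.vecMul_one]
  have horthJ : ∀ k ∈ J, inner ℂ (hQ.expL2 k) (toVec _ hw₀ - toVec _ hb) = 0 := by
    intro k hk
    rw [inner_sub_right, hEw₀, hwη.inner_eq hG, ← inner_sub_right]
    exact hηo _ (Submodule.le_topologicalClosure _ (Submodule.subset_span ⟨k, hk, rfl⟩))
  have horth : ∀ x ∈ (Submodule.span ℂ (hQ.expL2 '' J)).topologicalClosure,
      inner ℂ x (toVec _ hw₀ - toVec _ hb) = 0 := fun x hx =>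
    inner_eq_zero_of_mem_closure_span hx (by rintro _ ⟨k, hk, rfl⟩; exact horthJ k hk)
  -- `C` is the error of the estimate multiplied by `Q`
  set C : ℝ → Fin T → ℂ := fun t => ((symbolA T a t ᵥ* f t) ᵥ* (Q t)⁻¹ - b t) ᵥ* Q t with hCdef
  have hC : MemLp C 2 normFreq := memLp_vecMul (q := ∞) (hw₀.sub hb) hQ.bdd
  have hCΓ : toVec C hC ∈ freqSubspace T Γ := by
    refine mem_freqSubspace.2 fun k hk => ?_
    rw [inner_expL2_toVec, ← horthJ k ((notMem_gammaSet_iff s N K k.1).1 hk), toVec_sub,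
      hQ.inner_expL2]
  -- `C` solves the system `𝐁𝐜 = 𝐑𝐚`: the functions `e^{i n t} δ_ν Q⁻¹`, `n ∈ Γ`, are orthogonal to
  -- `L₂ˢ(f + g)`, so only `w₀` contributes to the rows of `𝐁𝐜`
  have hrow : ∀ k : ℤ × Fin T, k.1 ∈ Γ →
      inner ℂ (toeplitzRow _ hreg.inv k) (toVec C hC) = inner ℂ (expL2 k) (toVec _ hr) := by
    intro k hk
    have h0 : inner ℂ (hQ.dualL2 k) (toVec b hb) = 0 := by
      rw [← inner_conj_symm, inner_eq_zero_of_mem_closure_span hwmem, map_zero]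
      rintro _ ⟨l, hl, rfl⟩
      rw [← inner_conj_symm, hQ.inner_dualL2_expL2, map_zero]
      rintro rfl
      exact (notMem_gammaSet_iff s N K k.1).2 hl hk
    have h1 : inner ℂ (toeplitzRow _ hreg.inv k) (toVec C hC) =
        inner ℂ (hQ.dualL2 k) (toVec _ hw₀ - toVec b hb) := by
      rw [inner_toeplitzRow, toVec_sub, hQ.inner_dualL2]
      refine integral_congr_ae ?_
      filter_upwards [hQ.ae] with t ht
      rw [hCdef, ← ht.2.1, Matrix.mul_inv_rev, Matrix.vecMul_vecMul _ (Q t),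
        Matrix.mul_nonsing_inv_cancel_left _ _ ht.2.2]
    rw [h1, inner_sub_right, h0, sub_zero, hQ.inner_dualL2, inner_expL2_toVec]
    refine integral_congr_ae ?_
    filter_upwards [hQ.ae] with t ht
    rw [← ht.2.1, Matrix.mul_inv_rev, Matrix.vecMul_vecMul _ (Q t)⁻¹, Matrix.vecMul_vecMul]
  -- the spectral characteristic
  have hchar : ∀ᵐ t ∂normFreq, spectralChar a f g C t = b t ᵥ* (Q t)⁻¹ := by
    filter_upwards [hQ.ae] with t ht
    have e : C t = symbolA T a t ᵥ* f t - b t ᵥ* Q t := by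
      simp only [hCdef]
      rw [Matrix.sub_vecMul, Matrix.vecMul_vecMul _ _ (Q t), Matrix.nonsing_inv_mul _ ht.2.2,
        Matrix.vecMul_one]
    rw [spectralChar, e, sub_sub_cancel, ← ht.2.1, Matrix.mul_inv_rev, Matrix.vecMul_vecMul,
      Matrix.mul_nonsing_inv_cancel_left _ _ ht.2.2]
  have hcharQ : b =ᵐ[normFreq] fun t => spectralChar a f g C t ᵥ* Q t := by
    filter_upwards [hchar, hQ.ae] with t h1 ht
    rw [h1, Matrix.vecMul_vecMul, Matrix.nonsing_inv_mul _ ht.2.2, Matrix.vecMul_one]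
  have hh₀ : MemLp (fun t => spectralChar a f g C t ᵥ* Q t) 2 normFreq := hb.ae_eq hcharQ
  have eh : toVec b hb = toVec _ hh₀ := (toVec_eq_iff hb hh₀).2 hcharQ
  rw [eh] at hwmem hwη horth
  have hRa : Memℓp (coeffs Γ (toVec _ hr)) 2 := memℓp_coeffs _ _
  have hBc : BlockApply (blockB f g) Γ (coeffs Γ (toVec C hC)) (coeffs Γ (toVec _ hr)) := by
    have e : coeffs Γ (toVec _ hr) =
        fun (m : Γ) ν => inner ℂ (toeplitzRow _ hreg.inv ((m : ℤ), ν)) (toVec C hC) :=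
      funext fun m => funext fun ν => (hrow ((m : ℤ), ν) m.2).symm
    rw [e]
    exact blockApply_coeffs hreg.inv hCΓ
  have hself : inner ℂ (toVec _ hA) (toVec _ hAf) = ((‖Aζ‖ ^ 2 : ℝ) : ℂ) := by
    rw [← inner_conj_symm, ← inner_functional_self hT hζ hf ha hf2 hAf hAζ', inner_conj_symm,
      inner_self_eq_norm_sq_to_K]
    push_cast; rfl
  have hdC : inner ℂ (toVec C hC) (toVec _ hr) =
      ((‖toVec _ hw₀ - toVec _ hh₀‖ ^ 2 : ℝ) : ℂ) := by
    have h1 : inner ℂ (toVec _ hw₀ - toVec _ hh₀) (toVec _ hh₀) = 0 := by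
      rw [← inner_conj_symm, horth _ hwmem, map_zero]
    have h2 : ((‖toVec _ hw₀ - toVec _ hh₀‖ ^ 2 : ℝ) : ℂ) =
        inner ℂ (toVec _ hw₀ - toVec _ hh₀) (toVec _ hw₀ - toVec _ hh₀) := by
      rw [inner_self_eq_norm_sq_to_K]; push_cast; rfl
    rw [h2, inner_sub_right, h1, sub_zero, ← eh, toVec_sub, inner_toVec, inner_toVec]
    refine integral_congr_ae ?_
    filter_upwards [hQ.ae] with t ht
    have h3 := vecMul_dotProduct_star (symbolA T a t ᵥ* (f t * (f t + g t)⁻¹))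
      ((symbolA T a t ᵥ* f t) ᵥ* (Q t)⁻¹ - b t) (Q t)
    rw [ht.1.eq] at h3
    simp only [hCdef]
    rw [← h3, ← ht.2.1, Matrix.mul_inv_rev, ← Matrix.vecMul_vecMul, Matrix.vecMul_vecMul _ _ (Q t),
      Matrix.nonsing_inv_mul_cancel_right _ _ ht.2.2]
  have hdA : inner ℂ (toVec _ hA) (toVec _ hd) =
      ((‖Aζ‖ ^ 2 - ‖toVec _ hw₀‖ ^ 2 : ℝ) : ℂ) := by
    have h1 : ((‖toVec _ hw₀‖ ^ 2 : ℝ) : ℂ) = inner ℂ (toVec _ hw₀) (toVec _ hw₀) := by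
      rw [inner_self_eq_norm_sq_to_K]; push_cast; rfl
    rw [Complex.ofReal_sub, ← hself, h1, inner_toVec, inner_toVec, inner_toVec,
      ← integral_sub (integrable_dotProduct_star hA hAf) (integrable_dotProduct_star hw₀ hw₀)]
    refine integral_congr_ae ?_
    filter_upwards [hQ.ae, hreg.posf] with t ht hft
    have h2 : ((symbolA T a t ᵥ* f t) ᵥ* (Q t)⁻¹) ⬝ᵥ star ((symbolA T a t ᵥ* f t) ᵥ* (Q t)⁻¹) =
        ((((symbolA T a t ᵥ* f t) ᵥ* (Q t)⁻¹) ᵥ* (Q t)⁻¹) ᵥ* f t) ⬝ᵥ star (symbolA T a t) := by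
      have e := vecMul_dotProduct_star ((symbolA T a t ᵥ* f t) ᵥ* (Q t)⁻¹)
        (symbolA T a t ᵥ* f t) (Q t)⁻¹
      rw [ht.1.inv.eq] at e
      rw [vecMul_dotProduct_star _ _ (f t), hft.isHermitian.eq, e]
    -- `f (f + g)⁻¹ g = f - f (f + g)⁻¹ f`
    have h3 : f t * (f t + g t)⁻¹ * g t = f t - f t * (f t + g t)⁻¹ * f t := by
      rw [eq_sub_iff_add_eq, ← mul_add, add_comm (g t), mul_assoc, Matrix.nonsing_inv_mul, mul_one]
      rw [← ht.2.1, Matrix.det_mul]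
      exact ht.2.2.mul ht.2.2
    rw [h2, h3, Matrix.vecMul_sub, sub_dotProduct]
    congr 2
    rw [← ht.2.1, Matrix.mul_inv_rev]
    simp only [Matrix.vecMul_vecMul, mul_assoc]
  -- Pythagoras' theorem in both Hilbert spaces
  have hpyth₁ := norm_sub_sq_of_inner_eq_zero (x := 0) (w := η) (w₀ := Aζ)
    (hηo _ (H.sub_mem H.zero_mem hηH))
  have hpyth₂ := norm_sub_sq_of_inner_eq_zero (x := 0) (w := toVec _ hh₀) (w₀ := toVec _ hw₀)
    (horth _ (Submodule.sub_mem _ (Submodule.zero_mem _) hwmem))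
  rw [zero_sub, zero_sub, norm_neg, norm_neg] at hpyth₁ hpyth₂
  rw [hwη.norm_eq hG] at hpyth₂
  refine ⟨coeffs Γ (toVec _ hr), coeffs Γ (toVec C hC), coeffs Γ (toVec _ hd), C, Aζ, η,
    inner ℂ (toVec _ hA) (toVec _ hd), inner ℂ (toVec C hC) (toVec _ hr), hAζ, ?_, hRa,
    memℓp_coeffs _ _, hBc, ?_, isFourierSum_coeffs hC hCΓ, ?_, ?_, ?_, ?_, ?_, ?_,
    hasScalarProduct_coeffs hCΓ _, ?_, ?_⟩
  · rw [← coeffs_symbolA hT ha]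
    have e : coeffs Γ (toVec _ hr) =
        fun (m : Γ) ν => inner ℂ (toeplitzRow _ hR ((m : ℤ), ν)) (toVec _ hA) :=
      funext fun m => funext fun ν =>
        (inner_expL2_toVec ((m : ℤ), ν) hr).trans (inner_toeplitzRow hR ((m : ℤ), ν) hA).symm
    rw [e]
    exact blockApply_coeffs hR (symbolA_mem_freqSubspace hT ha hΓ)
  · intro c' hc' hBc'
    exact (hB.bijective _ hRa).unique ⟨hc', hBc'⟩ ⟨memℓp_coeffs _ _, hBc⟩
  · exact isOptimalCharacteristic_iff hT ha hreg hQ hAf hw₀ hh₀ hwmem horth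
  · filter_upwards [hmin.1] with t ht
    have e : (symbolA T a t ᵥ* f t) ᵥ* (f t + g t)⁻¹ + (symbolA T a t ᵥ* g t) ᵥ* (f t + g t)⁻¹ =
        symbolA T a t := by
      rw [← Matrix.add_vecMul, ← Matrix.vecMul_add, Matrix.vecMul_vecMul,
        Matrix.mul_nonsing_inv _ ((Matrix.isUnit_iff_isUnit_det _).1 ht), Matrix.vecMul_one]
    rw [spectralChar, Matrix.sub_vecMul, Matrix.add_vecMul]
    nth_rewrite 2 [← e]
    abel
  · intro η'
    rw [observationSpace_eq hT]
    exact isOptimalEstimate_iff hηH hηo η'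
  · intro η'
    rw [hQ.isSpectralIntegral_iff]
    constructor
    · rintro ⟨_, h⟩
      exact h.unique hG hwη
    · rintro rfl
      exact ⟨hh₀, hwη⟩
  · rw [← coeffs_symbolA hT ha]
    have e : coeffs Γ (toVec _ hd) =
        fun (m : Γ) ν => inner ℂ (toeplitzRow _ hD ((m : ℤ), ν)) (toVec _ hA) :=
      funext fun m => funext fun ν =>
        (inner_expL2_toVec ((m : ℤ), ν) hd).trans (inner_toeplitzRow hD ((m : ℤ), ν) hA).symm
    rw [e]
    exact blockApply_coeffs hD (symbolA_mem_freqSubspace hT ha hΓ)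
  · rw [← coeffs_symbolA hT ha]
    exact hasScalarProduct_coeffs (symbolA_mem_freqSubspace hT ha hΓ) _
  · rw [hdA, hdC, meanSquare_eq, ← Complex.ofReal_add]
    congr 1
    linarith
  · rw [hdA, hdC, spectralError_eq hT ha hreg hQ hAf hw₀ hh₀, hself, Complex.ofReal_re,
      norm_sub_rev, ← Complex.ofReal_add]
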